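/- Let $\mathcal A=\bigoplus_{n\in\mathcal Z}\mathcal A_n$ be a complex Lie algebra graded by an abelian group $\mathcal Z$ (written additively), so $[\mathcal A_m,\mathcal A_n]\subset\mathcal A_{m+n}$, with $\dim\mathcal A_n<\infty$ for all $n$ and $\mathcal A_0\neq 0$. Let $\langle\cdot,\cdot\rangle$ be a nondegenerate, symmetric, invariant bilinear form on $\mathcal A$ (that is, $\langle[X,Y],Z\rangle+\langle Y,[X,Z]\rangle=0$) with $\langle\mathcal A_m,\mathcal A_n\rangle=0$ whenever $m+n\neq0$. Put $\mathcal K=\mathcal A_0$, and for $\kappa\in\mathcal K$ let $(\mathrm{ad}\,\kappa)_n$ be the restriction of $\mathrm{ad}\,\kappa$ to $\mathcal A_n$. Let $\check{\mathcal K}\subset\mathcal K$ be a nonempty open subset such that for every $\kappa\in\check{\mathcal K}$ the spectrum of $(\mathrm{ad}\,\kappa)_n$ is disjoint from $2\pi i\mathbb Z$ for all $n\neq0$, and the spectrum of $(\mathrm{ad}\,\kappa)_0$ is disjoint from $2\pi i(\mathbb Z\setminus\{0\})$. Let $f(z)=\tfrac12\coth\tfrac z2-\tfrac1z$ (with the removable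 singularity at $0$ filled in, $f(0)=0$) and $F(z)=\tfrac12\coth\tfrac z2$. For $\kappa\in\check{\mathcal K}$ let $R(\kappa)\in\mathrm{End}(\mathcal A)$ be the linear operator preserving every $\mathcal A_n$ with $$R(\kappa)|_{\mathcal A_0}=f((\mathrm{ad}\,\kappa)_0),\qquad R(\kappa)|_{\mathcal A_n}=F((\mathrm{ad}\,\kappa)_n)\quad(n\neq0),$$ where $H(A)=\frac1{2\pi i}\oint_\Gamma H(z)(z-A)^{-1}\,dz$ is the holomorphic functional calculus, $\Gamma$ being a contour encircling the eigenvalues of $A$ inside the domain of holomorphy of $H$. Then for all $\kappa\in\check{\mathcal K}$ and $T\in\mathcal K$ the derivative $(\nabla_TR)(\kappa)=\frac{d}{dt}R(\kappa+tT)|_{t=0}$ exists (on each finite-dimensional piece $\mathcal A_n$), and the following hold for every $\kappa\in\check{\mathcal K}$. 1. (Modified classical dynamical Yang–Baxter equation.) For all $X,Y\in\mathcal A$, with $R=R(\kappa)$ and derivatives taken at $\kappa$, $$[RX,RY]-R([X,RY]+[RX,Y])+\langle X,(\nabla R)Y\rangle+(\nabla_{Y_{\mathcal K}}R)X-(\nabla_{X_{\mathcal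 K}}R)Y=-\tfrac14[X,Y],$$ where $X_{\mathcal K}$ is the component of $X$ in $\mathcal A_0$ and $\langle X,(\nabla R)Y\rangle=\sum_iK^i\langle X,(\nabla_{K_i}R)Y\rangle$ for dual bases $K_i$, $K^i$ of $\mathcal K$ ($\langle K_i,K^j\rangle=\delta_i^j$). 2. (Antisymmetry.) $\langle R(\kappa)X,Y\rangle=-\langle X,R(\kappa)Y\rangle$ for all $X,Y\in\mathcal A$. 3. ($\mathcal K$-equivariance.) $(\nabla_{[T,\kappa]}R)(\kappa)=[\mathrm{ad}\,T,R(\kappa)]$ for all $T\in\mathcal K$. -/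

import Mathlib

open scoped Topology

noncomputable section

namespace GradedRMatrix

/-! ### Holomorphic functional calculus in finite dimension -/

section FunctionalCalculus

/-- The normalised contour integral `(2πi)⁻¹ ∮ g` over small positively oriented circles around `w`.
For `g` holomorphic on a punctured neighbourhood of `w` the integral does not depend on the (small)
radius, so that the limit is the common value. -/
def smallContour (g : ℂ → ℂ) (w : ℂ) : ℂ :=
  Filter.limUnder (𝓝[>] (0 : ℝ)) fun r => (2 * Real.pi * Complex.I)⁻¹ * ∮ z in C(w, r), g z

/-- The holomorphic functional calculus
`H(A) = (2πi)⁻¹ ∮_Γ H(z) (z - A)⁻¹ dz`, where `Γ` consists of a small positively oriented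
circle around each eigenvalue of `A`. The operator-valued integral is taken entrywise in a basis.
For `H` holomorphic on a neighbourhood of the spectrum of `A` this is the usual `H(A)`. -/
def holCalc {V : Type*} [AddCommGroup V] [Module ℂ V] [FiniteDimensional ℂ V]
    (H : ℂ → ℂ) (A : Module.End ℂ V) : Module.End ℂ V :=
  Matrix.toLin (Module.finBasis ℂ V) (Module.finBasis ℂ V) <| Matrix.of fun i j =>
    ∑ w ∈ (Module.End.finite_spectrum A).toFinset,
      smallContour (fun z => H z *
        LinearMap.toMatrix (Module.finBasis ℂ V) (Module.finBasis ℂ V) (resolvent A z) i j) w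

/-- `F(z) = ½ coth (z / 2)`. -/
def coefF (z : ℂ) : ℂ := (1 / 2) * (Complex.cosh (z / 2) / Complex.sinh (z / 2))

/-- `f(z) = ½ coth (z / 2) - 1 / z`; the singularity at `0` is removable, with value `0`,
and `0` is also what the formula yields at `z = 0` because `x / 0 = 0`. -/
def coeff (z : ℂ) : ℂ := (1 / 2) * (Complex.cosh (z / 2) / Complex.sinh (z / 2)) - 1 / z

end FunctionalCalculus

/-! ### Directional derivatives of operator-valued functions on `A_0` -/

section Derivative

variable {Z : Type*} [AddCommGroup Z] {A : Type*} [AddCommGroup A] [Module ℂ A]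
variable {𝒜 : Z → Submodule ℂ A}

/-- `D` is the derivative `d/dt R(κ + tT)` at `t = 0` (complex `t`), i.e.
`D Y = d/dt R(κ + tT) Y` for all `Y`, in all linear coordinates of `A`. If `R(κ)` preserves the
finite-dimensional spaces `A_n`, this is the derivative in every `End(A_n)`. -/
def HasDirDeriv (R : 𝒜 0 → Module.End ℂ A) (κ T : 𝒜 0) (D : Module.End ℂ A) : Prop :=
  ∀ (Y : A) (φ : Module.Dual ℂ A), HasDerivAt (fun t : ℂ => φ (R (κ + t • T) Y)) (φ (D Y)) 0

theorem HasDirDeriv.unique {R : 𝒜 0 → Module.End ℂ A} {κ T : 𝒜 0} {D D' : Module.End ℂ A}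
    (h : HasDirDeriv R κ T D) (h' : HasDirDeriv R κ T D') : D = D' := by
  ext Y
  rw [← sub_eq_zero, ← Module.forall_dual_apply_eq_zero_iff ℂ]
  intro φ
  rw [map_sub, sub_eq_zero]
  exact (h Y φ).unique (h' Y φ)

open Classical in
/-- `(∇_T R)(κ)`, the derivative of `R` at `κ` in the direction `T` (zero if there is none). -/
def nabla (R : 𝒜 0 → Module.End ℂ A) (κ T : 𝒜 0) : Module.End ℂ A :=
  if h : ∃ D, HasDirDeriv R κ T D then h.choose else 0

end Derivative

/-! ### The `r`-matrix of a graded Lie algebra -/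

section Graded

variable {Z : Type*} [AddCommGroup Z] [DecidableEq Z]
variable {A : Type*} [LieRing A] [LieAlgebra ℂ A]
variable (𝒜 : Z → Submodule ℂ A) [GradedLieAlgebra 𝒜]

/-- `(ad κ)_n`, the restriction of `ad κ` to `A_n`, for `κ ∈ A_0`. -/
def adPiece (κ : 𝒜 0) (n : Z) : Module.End ℂ (𝒜 n) :=
  (LieAlgebra.ad ℂ A (κ : A)).restrict (p := 𝒜 n) (q := 𝒜 n) fun x hx => by
    have h := SetLike.GradedBracket.bracket_mem (ℒ := 𝒜) κ.2 hx
    rw [zero_add] at h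
    simpa using h

/-- The spectral conditions: `spec (ad κ)_n ∩ 2πiℤ = ∅` for all `n ≠ 0`, and
`spec (ad κ)_0 ∩ 2πi(ℤ ∖ {0}) = ∅`. -/
def SpectralCondition (κ : 𝒜 0) : Prop :=
  (∀ n : Z, n ≠ 0 → ∀ k : ℤ, 2 * Real.pi * Complex.I * k ∉ spectrum ℂ (adPiece 𝒜 κ n)) ∧
  (∀ k : ℤ, k ≠ 0 → 2 * Real.pi * Complex.I * k ∉ spectrum ℂ (adPiece 𝒜 κ 0))

/-- `R(κ)`: the operator on `A` that preserves every `A_n`, equals `f((ad κ)_0)` on `A_0`, and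
equals `F((ad κ)_n)` on `A_n` for `n ≠ 0`. -/
def rMatrix [∀ n, FiniteDimensional ℂ (𝒜 n)] (κ : 𝒜 0) : Module.End ℂ A :=
  DirectSum.coeLinearMap 𝒜 ∘ₗ
    DirectSum.lmap (fun n : Z => holCalc (if n = 0 then coeff else coefF) (adPiece 𝒜 κ n)) ∘ₗ
    (DirectSum.decomposeLinearEquiv 𝒜).toLinearMap

variable {𝒜}

theorem restrict_nondegenerate {B : LinearMap.BilinForm ℂ A} (hnd : B.Nondegenerate)
    (hB : ∀ m n : Z, m + n ≠ 0 → ∀ x ∈ 𝒜 m, ∀ y ∈ 𝒜 n, B x y = 0) :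
    (B.restrict (𝒜 0)).Nondegenerate := by
  classical
  have key : ∀ (ψ : A →ₗ[ℂ] ℂ), (∀ y ∈ 𝒜 0, ψ y = 0) → (∀ n : Z, n ≠ 0 → ∀ y ∈ 𝒜 n, ψ y = 0) →
      ψ = 0 := by
    intro ψ h0 h1
    ext y
    induction y using DirectSum.Decomposition.inductionOn 𝒜 with
    | zero => simp
    | @homogeneous i m =>
      by_cases hi : i = 0
      · subst hi; exact h0 _ m.2
      · exact h1 i hi _ m.2
    | add a b ha hb => simp [ha, hb]
  constructor
  · intro x hx
    have : B (x : A) = 0 := key _ (fun y hy => hx ⟨y, hy⟩)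
      (fun n hn y hy => hB 0 n (by simpa using hn) _ x.2 _ hy)
    exact Subtype.ext (hnd.1 _ fun y => by rw [this]; rfl)
  · intro x hx
    have : B.flip (x : A) = 0 := key _ (fun y hy => hx ⟨y, hy⟩)
      (fun n hn y hy => hB n 0 (by simpa using hn) _ hy _ x.2)
    exact Subtype.ext (hnd.2 _ fun y => by
      change B.flip (x : A) y = 0
      rw [this]; rfl)

/-- `⟨X, (∇R)(κ) Y⟩ = ∑ i, K^i ⟨X, (∇_{K_i} R)(κ) Y⟩`, where `K_i` is the basis `b` of `A_0` and
`K^i` is the dual basis with respect to the (nondegenerate) restriction of the form to `A_0`. -/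
def nablaPairing (B : LinearMap.BilinForm ℂ A) (hB : (B.restrict (𝒜 0)).Nondegenerate)
    {ι : Type*} [Fintype ι] [DecidableEq ι] (b : Module.Basis ι ℂ (𝒜 0))
    (R : 𝒜 0 → Module.End ℂ A) (κ : 𝒜 0) (X Y : A) : A :=
  ∑ i, B X (nabla R κ (b i) Y) • ((B.restrict (𝒜 0)).dualBasis hB b i : A)

end Graded

end GradedRMatrix

end

open GradedRMatrix

/-! Put F(z) = ½ coth(z/2). If D, M, N satisfy the Leibniz rule for a bilinear map, their
exponentials multiply along it, so the addition theorem of coth becomes [Fx, Fy] − F([x, Fy] + [Fx,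
y]) = −¼[x, y] (`coth_addition`). This would be the whole equation, without derivative terms, if F
could be evaluated everywhere; but on A_0 the operator ad κ has the eigenvalue 0, a pole of F.

The remedy is to shift: ad κ + t on A_m and on A_n, ad κ + 2t on A_{m+n}. The Leibniz rule survives
(`pieceBracket_leibniz`), and for small t ≠ 0 no pole is met. On A_0 write F = f + 1/z. The terms
with two inverses cancel (`shiftedInv_bracket`), and those with one inverse remain
(`shifted_yang_baxter`). As t → 0 they become the three derivative terms: `tendsto_left_pole`,
`tendsto_right_pole`, `tendsto_pairing`.

All three limits rest on one computation, `tendsto_rDeriv`. If (ad κ + s − t)T' = T, then ad T = (ad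
κ + s) ad T' − ad T' (ad κ + t). Hence H(ad κ + s) ad T' − ad T' H(ad κ + t) is the divided
difference of H applied to ad T. It is continuous in the shifts, and at zero shift it is the
derivative of H(ad κ) along T.

A divided difference is the corner entry of H at a block triangular operator. With H a quotient of
everywhere convergent power series, this description also yields the derivative
(`hasDerivAt_quot_apply`), equivariance (`rDeriv_bracket`) and the agreement with the contour
integral (`holCalc_eq_quot`). Antisymmetry holds because ad κ is skew and f, F are odd. -/

namespace FinDimCalculus

/-! ### Entire functions in a Banach algebra -/

section Banach

/-- Coefficients of a power series dominated by a multiple of the exponential series. -/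
def ExpBounded (c : ℕ → ℂ) : Prop := ∃ M : ℝ, 0 ≤ M ∧ ∀ k, ‖c k‖ ≤ M * (k.factorial : ℝ)⁻¹

variable {E : Type*} [NormedRing E]

/-- The sum of the power series with coefficients `c`. -/
noncomputable def entire [NormedAlgebra ℂ E] (c : ℕ → ℂ) (a : E) : E := ∑' k, c k • a ^ k

theorem norm_pow_le_mul (a : E) {r : ℝ} (ha : ‖a‖ ≤ r) (k : ℕ) :
    ‖a ^ k‖ ≤ (‖(1 : E)‖ + 1) * r ^ k := by
  have hr : 0 ≤ r := (norm_nonneg a).trans ha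
  rcases Nat.eq_zero_or_pos k with rfl | hk
  · simp
  · calc ‖a ^ k‖ ≤ ‖a‖ ^ k := norm_pow_le' a hk
      _ ≤ r ^ k := by gcongr
      _ ≤ (‖(1 : E)‖ + 1) * r ^ k :=
        le_mul_of_one_le_left (by positivity) (by linarith [norm_nonneg (1 : E)])

theorem summable_bound (M r : ℝ) :
    Summable fun k : ℕ => M * (‖(1 : E)‖ + 1) * (r ^ k / k.factorial) :=
  (Real.summable_pow_div_factorial r).mul_left _

variable [NormedAlgebra ℂ E]

theorem norm_term_le {c : ℕ → ℂ} {M : ℝ} (hM : 0 ≤ M) (hc : ∀ k, ‖c k‖ ≤ M * (k.factorial : ℝ)⁻¹)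
    (a : E) {r : ℝ} (ha : ‖a‖ ≤ r) (k : ℕ) :
    ‖c k • a ^ k‖ ≤ M * (‖(1 : E)‖ + 1) * (r ^ k / k.factorial) := by
  have hr : 0 ≤ r := (norm_nonneg a).trans ha
  calc ‖c k • a ^ k‖ ≤ ‖c k‖ * ‖a ^ k‖ := norm_smul_le _ _
    _ ≤ (M * (k.factorial : ℝ)⁻¹) * ((‖(1 : E)‖ + 1) * r ^ k) :=
      mul_le_mul (hc k) (norm_pow_le_mul a ha k) (norm_nonneg _) (by positivity)
    _ = _ := by ring

theorem continuous_bilin [FiniteDimensional ℂ E] {F : Type*} [NormedAddCommGroup F]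
    [NormedSpace ℂ F] [FiniteDimensional ℂ F] (b : E →ₗ[ℂ] F →ₗ[ℂ] ℂ) :
    Continuous fun p : E × F => b p.1 p.2 := by
  have h : Continuous (LinearMap.toContinuousLinearMap.toLinearMap ∘ₗ b : E →ₗ[ℂ] F →L[ℂ] ℂ) :=
    LinearMap.continuous_of_finiteDimensional _
  exact (h.comp continuous_fst).clm_apply continuous_snd

theorem tendsto_add_smul (a b : E) : Filter.Tendsto (fun t : ℂ => a + t • b) (𝓝 0) (𝓝 a) := by
  have : Continuous fun t : ℂ => a + t • b := by fun_prop
  simpa using this.tendsto 0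

variable [CompleteSpace E]

theorem ExpBounded.hasSum {c : ℕ → ℂ} (hc : ExpBounded c) (a : E) :
    HasSum (fun k => c k • a ^ k) (entire c a) := by
  obtain ⟨M, hM, hc⟩ := hc
  exact (Summable.of_norm_bounded (summable_bound (E := E) M ‖a‖)
    fun k => norm_term_le hM hc a le_rfl k).hasSum

theorem ExpBounded.continuous {c : ℕ → ℂ} (hc : ExpBounded c) :
    Continuous (entire c : E → E) := by
  obtain ⟨M, hM, hc⟩ := hc
  rw [continuous_iff_continuousAt]
  intro a
  have h : ContinuousOn (entire c : E → E) (Metric.ball 0 (‖a‖ + 1)) := by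
    refine continuousOn_tsum (fun k => by fun_prop) (summable_bound (E := E) M (‖a‖ + 1)) ?_
    intro k x hx
    exact norm_term_le hM hc x (by simpa using (Metric.mem_ball.1 hx).le) k
  exact h.continuousAt (Metric.isOpen_ball.mem_nhds (by simp))

theorem ExpBounded.shift {c : ℕ → ℂ} (hc : ExpBounded c) : ExpBounded fun k => c (k + 1) := by
  obtain ⟨M, hM, hc⟩ := hc
  refine ⟨M, hM, fun k => (hc (k + 1)).trans ?_⟩
  gcongr
  omega

/-- Division of a power series by its variable; it later splits the pole of coth at 0 from the
regular part. -/
theorem entire_eq_add_mul_shift {c : ℕ → ℂ} (hc : ExpBounded c) (a : E) :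
    entire c a = c 0 • 1 + a * entire (fun k => c (k + 1)) a := by
  have h1 : HasSum (fun k => c (k + 1) • a ^ (k + 1)) (a * entire (fun k => c (k + 1)) a) := by
    simpa only [mul_smul_comm, ← pow_succ'] using (hc.shift.hasSum a).mul_left a
  have h2 := (hasSum_nat_add_iff' (f := fun k => c k • a ^ k) 1).2 (hc.hasSum a)
  have h3 := h1.unique h2
  rw [h3]
  simp

theorem ExpBounded.sub {c d : ℕ → ℂ} (hc : ExpBounded c) (hd : ExpBounded d) :
    ExpBounded fun k => c k - d k := by
  obtain ⟨M, hM, hc⟩ := hc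
  obtain ⟨N, hN, hd⟩ := hd
  refine ⟨M + N, by positivity, fun k => (norm_sub_le _ _).trans ?_⟩
  linarith [hc k, hd k, add_mul M N (k.factorial : ℝ)⁻¹]

theorem entire_sub {c d : ℕ → ℂ} (hc : ExpBounded c) (hd : ExpBounded d) (a : E) :
    entire (fun k => c k - d k) a = entire c a - entire d a := by
  refine (((hc.sub hd).hasSum a).unique ?_)
  simpa only [sub_smul] using (hc.hasSum a).sub (hd.hasSum a)

/-- The quotient of two power series. -/
noncomputable def quot (c d : ℕ → ℂ) (a : E) : E := entire c a * Ring.inverse (entire d a)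

theorem continuousAt_quot {c d : ℕ → ℂ} (hc : ExpBounded c) (hd : ExpBounded d) {a : E}
    (ha : IsUnit (entire d a)) : ContinuousAt (quot c d : E → E) a := by
  obtain ⟨u, hu⟩ := ha
  have h1 : ContinuousAt (Ring.inverse : E → E) (entire d a) := by
    rw [← hu]; exact NormedRing.inverse_continuousAt u
  exact hc.continuous.continuousAt.mul
    (ContinuousAt.comp (g := (Ring.inverse : E → E)) h1 hd.continuous.continuousAt)

theorem eventually_isUnit_entire {d : ℕ → ℂ} (hd : ExpBounded d) {a : E}
    (ha : IsUnit (entire d a)) : ∀ᶠ b in 𝓝 a, IsUnit (entire d b) :=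
  hd.continuous.continuousAt.eventually (Units.isOpen.mem_nhds ha)

end Banach

/-! ### Operators on finite-dimensional spaces -/

section Operators

variable {V : Type*} [AddCommGroup V] [Module ℂ V]
variable {W : Type*} [AddCommGroup W] [Module ℂ W]

theorem pow_intertwine {T : V →ₗ[ℂ] W} {M : Module.End ℂ V} {N : Module.End ℂ W}
    (h : ∀ v, T (M v) = N (T v)) (k : ℕ) (v : V) : T ((M ^ k) v) = (N ^ k) (T v) := by
  induction k generalizing v with
  | zero => simp
  | succ k ih => rw [pow_succ', pow_succ', Module.End.mul_apply, Module.End.mul_apply, h, ih]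

/-- The operator `(v, w) ↦ (M v + K w, N w)` on `V × W`. -/
def upperBlock (M : Module.End ℂ V) (K : W →ₗ[ℂ] V) (N : Module.End ℂ W) :
    Module.End ℂ (V × W) :=
  (M ∘ₗ LinearMap.fst ℂ V W + K ∘ₗ LinearMap.snd ℂ V W).prod (N ∘ₗ LinearMap.snd ℂ V W)

@[simp]
theorem upperBlock_apply (M : Module.End ℂ V) (K : W →ₗ[ℂ] V) (N : Module.End ℂ W) (x : V × W) :
    upperBlock M K N x = (M x.1 + K x.2, N x.2) := rfl

variable [FiniteDimensional ℂ V] [FiniteDimensional ℂ W]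
variable {U : Type*} [AddCommGroup U] [Module ℂ U] [FiniteDimensional ℂ U]

section Norm

attribute [local instance] Matrix.linftyOpNormedRing Matrix.linftyOpNormedAlgebra

/-- A submultiplicative norm on the endomorphisms of a finite-dimensional complex space. -/
noncomputable abbrev endNormedRing : NormedRing (Module.End ℂ V) :=
  NormedRing.induced (Module.End ℂ V) _ (LinearMap.toMatrixAlgEquiv (Module.finBasis ℂ V))
    (LinearMap.toMatrixAlgEquiv (Module.finBasis ℂ V)).injective

noncomputable abbrev endNormedAlgebra :
    @NormedAlgebra ℂ (Module.End ℂ V) _ endNormedRing.toSeminormedRing :=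
  letI : NormedRing (Module.End ℂ V) := endNormedRing
  NormedAlgebra.induced ℂ (Module.End ℂ V) _ (LinearMap.toMatrixAlgEquiv (Module.finBasis ℂ V))

end Norm

attribute [local instance] endNormedRing endNormedAlgebra

instance endCompleteSpace : CompleteSpace (Module.End ℂ V) := FiniteDimensional.complete ℂ _

theorem continuous_dual_apply (φ : Module.Dual ℂ V) (v : V) :
    Continuous fun M : Module.End ℂ V => φ (M v) :=
  LinearMap.continuous_of_finiteDimensional (φ ∘ₗ LinearMap.applyₗ v)

/-- Series are compared only after pairing with functionals, so the spaces themselves need no norm.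
-/
theorem hasSum_entire_apply {c : ℕ → ℂ} (hc : ExpBounded c) (M : Module.End ℂ V) (v : V)
    (φ : Module.Dual ℂ V) : HasSum (fun k => c k * φ ((M ^ k) v)) (φ (entire c M v)) := by
  have := (hc.hasSum M).map (φ ∘ₗ LinearMap.applyₗ v) (continuous_dual_apply φ v)
  simpa [Function.comp_def] using this

theorem eq_of_forall_dual {v w : V} (h : ∀ φ : Module.Dual ℂ V, φ v = φ w) : v = w := by
  rw [← sub_eq_zero, ← Module.forall_dual_apply_eq_zero_iff ℂ]
  intro φ
  rw [map_sub, h, sub_self]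

theorem entire_intertwine {c : ℕ → ℂ} (hc : ExpBounded c) {T : V →ₗ[ℂ] W} {M : Module.End ℂ V}
    {N : Module.End ℂ W} (h : ∀ v, T (M v) = N (T v)) (v : V) :
    T (entire c M v) = entire c N (T v) := by
  refine eq_of_forall_dual fun φ => ?_
  have h1 := hasSum_entire_apply hc M v (φ ∘ₗ T)
  simp only [LinearMap.comp_apply, pow_intertwine h] at h1
  exact h1.unique (hasSum_entire_apply hc N (T v) φ)

theorem entire_adjoint {c : ℕ → ℂ} (hc : ExpBounded c) (β : V →ₗ[ℂ] W →ₗ[ℂ] ℂ)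
    {M : Module.End ℂ V} {N : Module.End ℂ W} (h : ∀ v w, β (M v) w = β v (N w)) (v : V) (w : W) :
    β (entire c M v) w = β v (entire c N w) := by
  have hk : ∀ (k : ℕ) v w, β ((M ^ k) v) w = β v ((N ^ k) w) := by
    intro k
    induction k with
    | zero => simp
    | succ k ih =>
      intro v w
      rw [pow_succ', pow_succ, Module.End.mul_apply, Module.End.mul_apply, h, ih]
  have h1 := hasSum_entire_apply hc M v (β.flip w)
  simp only [LinearMap.flip_apply, hk] at h1
  exact h1.unique (hasSum_entire_apply hc N w (β v))

theorem quot_apply_entire {c d : ℕ → ℂ} {M : Module.End ℂ V} (hM : IsUnit (entire d M)) (v : V) :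
    quot c d M (entire d M v) = entire c M v := by
  rw [quot, Module.End.mul_apply, ← Module.End.mul_apply _ (entire d M),
    Ring.inverse_mul_cancel _ hM, Module.End.one_apply]

theorem exists_entire_apply_eq {d : ℕ → ℂ} {M : Module.End ℂ V} (hM : IsUnit (entire d M)) (v : V) :
    ∃ u, entire d M u = v :=
  ⟨Ring.inverse (entire d M) v, by
    rw [← Module.End.mul_apply, Ring.mul_inverse_cancel _ hM, Module.End.one_apply]⟩

/-- Writing the argument as d(M)u clears the denominator; what remains is intertwining of powers. -/
theorem quot_intertwine {c d : ℕ → ℂ} (hc : ExpBounded c) (hd : ExpBounded d) {T : V →ₗ[ℂ] W}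
    {M : Module.End ℂ V} {N : Module.End ℂ W} (hM : IsUnit (entire d M))
    (hN : IsUnit (entire d N)) (h : ∀ v, T (M v) = N (T v)) (v : V) :
    T (quot c d M v) = quot c d N (T v) := by
  obtain ⟨u, rfl⟩ := exists_entire_apply_eq hM v
  rw [quot_apply_entire hM, entire_intertwine hc h, entire_intertwine hd h, quot_apply_entire hN]

theorem quot_adjoint {c d : ℕ → ℂ} (hc : ExpBounded c) (hd : ExpBounded d)
    (β : V →ₗ[ℂ] W →ₗ[ℂ] ℂ) {M : Module.End ℂ V} {N : Module.End ℂ W} (hM : IsUnit (entire d M))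
    (hN : IsUnit (entire d N)) (h : ∀ v w, β (M v) w = β v (N w)) (v : V) (w : W) :
    β (quot c d M v) w = β v (quot c d N w) := by
  obtain ⟨v, rfl⟩ := exists_entire_apply_eq hM v
  obtain ⟨w, rfl⟩ := exists_entire_apply_eq hN w
  have hcomm : entire d N (entire c N w) = entire c N (entire d N w) :=
    (entire_intertwine hc (T := entire d N)
      (fun v => ((entire_intertwine hd (T := N) fun _ => rfl) v).symm) w)
  rw [quot_apply_entire hM, quot_apply_entire hN, entire_adjoint hc β h, entire_adjoint hd β h,
    hcomm]

theorem entire_apply_of_eigenvector {d : ℕ → ℂ} (hd : ExpBounded d) {M : Module.End ℂ V} {μ : ℂ}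
    {v : V} (hv : M v = μ • v) : entire d M v = entire d μ • v := by
  refine eq_of_forall_dual fun φ => (hasSum_entire_apply hd M v φ).unique ?_
  have hk : ∀ k : ℕ, (M ^ k) v = μ ^ k • v := by
    intro k
    induction k with
    | zero => simp
    | succ k ih => rw [pow_succ', Module.End.mul_apply, ih, map_smul, hv, smul_smul, pow_succ]
  simpa [hk, mul_assoc] using (hd.hasSum μ).mul_right (φ v)

/-- Injectivity of `entire d M` can be tested on eigenvectors of `M`. -/
theorem isUnit_entire_iff {d : ℕ → ℂ} (hd : ExpBounded d) {M : Module.End ℂ V} :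
    IsUnit (entire d M) ↔ ∀ μ, M.HasEigenvalue μ → entire d μ ≠ 0 := by
  constructor
  · intro hM μ hμ h0
    obtain ⟨v, hv⟩ := hμ.exists_hasEigenvector
    have h1 := entire_apply_of_eigenvector hd hv.apply_eq_smul
    rw [h0, zero_smul] at h1
    have hinj := ((Module.End.isUnit_iff _).1 hM).injective
    exact hv.2 (hinj (by rw [h1, map_zero]))
  · intro h
    -- The kernel of d(M) is M-invariant; if nonzero, it contains an eigenvector of M, whose
    -- eigenvalue is a zero of d.
    by_contra hM
    have hker : LinearMap.ker (entire d M) ≠ ⊥ := fun hk => hM (by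
      rwa [LinearMap.isUnit_iff_ker_eq_bot])
    have hinv : ∀ x ∈ LinearMap.ker (entire d M), M x ∈ LinearMap.ker (entire d M) := by
      intro x hx
      rw [LinearMap.mem_ker] at hx ⊢
      rw [← entire_intertwine hd (T := M) (fun _ => rfl), hx, map_zero]
    have : Nontrivial (LinearMap.ker (entire d M)) := Submodule.nontrivial_iff_ne_bot.2 hker
    obtain ⟨μ, hμ⟩ := Module.End.exists_eigenvalue (M.restrict hinv)
    obtain ⟨x, hx⟩ := hμ.exists_hasEigenvector
    have hx' : M x = μ • (x : V) := congrArg Subtype.val hx.apply_eq_smul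
    have hx0 : (x : V) ≠ 0 := fun h0 => hx.2 (Subtype.ext h0)
    refine h μ (Module.End.hasEigenvalue_of_hasEigenvector
      (Module.End.hasEigenvector_iff.2 ⟨Module.End.mem_eigenspace_iff.2 hx', hx0⟩)) ?_
    have h1 := entire_apply_of_eigenvector hd hx'
    rw [LinearMap.mem_ker.1 x.2] at h1
    exact (smul_eq_zero.1 h1.symm).resolve_right hx0

theorem quot_apply_of_eigenvector {c d : ℕ → ℂ} (hc : ExpBounded c) (hd : ExpBounded d)
    {M : Module.End ℂ V} (hM : IsUnit (entire d M)) {μ : ℂ} (hμ : entire d μ ≠ 0) {v : V}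
    (hv : M v = μ • v) : quot c d M v = (entire c μ / entire d μ) • v := by
  have h := quot_apply_entire (c := c) hM v
  rw [entire_apply_of_eigenvector hd hv, entire_apply_of_eigenvector hc hv, map_smul] at h
  rw [div_eq_inv_mul, mul_smul, ← h, smul_smul, inv_mul_cancel₀ hμ, one_smul]

/-! ### Divided differences -/

theorem isUnit_entire_upperBlock {d : ℕ → ℂ} (hd : ExpBounded d) {M : Module.End ℂ V}
    {N : Module.End ℂ W} (hM : IsUnit (entire d M)) (hN : IsUnit (entire d N)) (K : W →ₗ[ℂ] V) :
    IsUnit (entire d (upperBlock M K N)) := by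
  rw [isUnit_entire_iff hd] at *
  intro μ hμ
  obtain ⟨⟨v, w⟩, hx⟩ := hμ.exists_hasEigenvector
  have h := hx.apply_eq_smul
  simp only [upperBlock_apply, Prod.smul_mk, Prod.mk.injEq] at h
  by_cases hw : w = 0
  · subst hw
    refine hM μ (Module.End.hasEigenvalue_of_hasEigenvector
      (x := v) (Module.End.hasEigenvector_iff.2
        ⟨Module.End.mem_eigenspace_iff.2 (by simpa using h.1), ?_⟩))
    rintro rfl
    exact hx.2 rfl
  · exact hN μ (Module.End.hasEigenvalue_of_hasEigenvector
      (Module.End.hasEigenvector_iff.2 ⟨Module.End.mem_eigenspace_iff.2 h.2, hw⟩))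

/-- The divided difference of `c / d` at `(M, N)`, applied to `K`: the upper right corner of the
value of `c / d` at the block matrix with rows `(M, K)` and `(0, N)`. -/
noncomputable def dividedDiff (c d : ℕ → ℂ) (M : Module.End ℂ V) (N : Module.End ℂ W) (K : W →ₗ[ℂ] V) :
    W →ₗ[ℂ] V :=
  LinearMap.fst ℂ V W ∘ₗ quot c d (upperBlock M K N) ∘ₗ LinearMap.inr ℂ V W

/-- For K = ML − LN the map w ↦ (−Lw, w) intertwines N with the block operator, and v ↦ (v, 0)
intertwines M with it. The formula follows from (0, w) = (−Lw, w) + (Lw, 0). -/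
theorem dividedDiff_apply_of_intertwine {c d : ℕ → ℂ} (hc : ExpBounded c) (hd : ExpBounded d)
    {M : Module.End ℂ V} {N : Module.End ℂ W} (hM : IsUnit (entire d M))
    (hN : IsUnit (entire d N)) {K L : W →ₗ[ℂ] V} (hK : ∀ w, K w = M (L w) - L (N w)) (w : W) :
    dividedDiff c d M N K w = quot c d M (L w) - L (quot c d N w) := by
  have hB := isUnit_entire_upperBlock hd hM hN K
  have h1 := quot_intertwine hc hd hN hB (T := (-L).prod LinearMap.id)
    (fun w => by simp [hK, neg_add_eq_sub]) w
  have h2 := quot_intertwine hc hd hM hB (T := LinearMap.inl ℂ V W) (fun v => by simp) (L w)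
  have h3 : LinearMap.inr ℂ V W w = (-L).prod LinearMap.id w + LinearMap.inl ℂ V W (L w) := by
    simp
  simp only [dividedDiff, LinearMap.comp_apply]
  rw [h3, map_add, ← h1, ← h2]
  simp [sub_eq_neg_add]

/-- id × T intertwines the two block operators. Linearity in K follows by taking T scalar, or one of
the two inclusions or the diagonal of W × W. -/
theorem dividedDiff_apply_map {c d : ℕ → ℂ} (hc : ExpBounded c) (hd : ExpBounded d)
    {M : Module.End ℂ V} {N : Module.End ℂ W} {N' : Module.End ℂ U} (hM : IsUnit (entire d M))
    (hN : IsUnit (entire d N)) (hN' : IsUnit (entire d N')) {K : W →ₗ[ℂ] V} {K' : U →ₗ[ℂ] V}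
    {T : W →ₗ[ℂ] U} (hT : ∀ w, T (N w) = N' (T w)) (hK : ∀ w, K w = K' (T w)) (w : W) :
    dividedDiff c d M N K w = dividedDiff c d M N' K' (T w) := by
  have h := quot_intertwine hc hd (isUnit_entire_upperBlock hd hM hN K)
    (isUnit_entire_upperBlock hd hM hN' K') (T := LinearMap.id.prodMap T)
    (fun x => by simp [hT, hK]) (0, w)
  have h1 := congrArg Prod.fst h
  simpa [dividedDiff] using h1

theorem dividedDiff_smul {c d : ℕ → ℂ} (hc : ExpBounded c) (hd : ExpBounded d)
    {M : Module.End ℂ V} {N : Module.End ℂ W} (hM : IsUnit (entire d M))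
    (hN : IsUnit (entire d N)) (s : ℂ) (K : W →ₗ[ℂ] V) :
    dividedDiff c d M N (s • K) = s • dividedDiff c d M N K := by
  ext w
  rw [dividedDiff_apply_map hc hd hM hN hN (T := s • LinearMap.id) (K' := K) (by simp) (by simp)]
  simp

theorem dividedDiff_add {c d : ℕ → ℂ} (hc : ExpBounded c) (hd : ExpBounded d)
    {M : Module.End ℂ V} {N : Module.End ℂ W} (hM : IsUnit (entire d M))
    (hN : IsUnit (entire d N)) (K K' : W →ₗ[ℂ] V) :
    dividedDiff c d M N (K + K') = dividedDiff c d M N K + dividedDiff c d M N K' := by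
  ext w
  have hNN := isUnit_entire_upperBlock hd hN hN 0
  rw [LinearMap.add_apply,
    dividedDiff_apply_map hc hd hM hN hNN (T := LinearMap.inl ℂ W W) (K := K) (K' := K.coprod K')
      (by simp) (by simp),
    dividedDiff_apply_map hc hd hM hN hNN (T := LinearMap.inr ℂ W W) (K := K') (K' := K.coprod K')
      (by simp) (by simp),
    dividedDiff_apply_map hc hd hM hN hNN (T := LinearMap.id.prod LinearMap.id) (K := K + K')
      (K' := K.coprod K') (by simp) (by simp), ← map_add]
  simp

theorem tendsto_dividedDiff {c d : ℕ → ℂ} (hc : ExpBounded c) (hd : ExpBounded d)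
    {M P : Module.End ℂ V} {N Q : Module.End ℂ W} (K : W →ₗ[ℂ] V)
    (hM : IsUnit (entire d M)) (hN : IsUnit (entire d N)) (φ : Module.Dual ℂ V) (w : W) :
    Filter.Tendsto (fun t : ℂ => φ (dividedDiff c d (M + t • P) (N + t • Q) K w)) (𝓝 0)
      (𝓝 (φ (dividedDiff c d M N K w))) := by
  have hB : ∀ t : ℂ, upperBlock (M + t • P) K (N + t • Q) =
      upperBlock M K N + t • upperBlock P 0 Q := by
    intro t
    ext x <;> simp
  have hlim : Filter.Tendsto (fun t : ℂ => upperBlock (M + t • P) K (N + t • Q)) (𝓝 0)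
      (𝓝 (upperBlock M K N)) := by
    simp only [hB]
    exact tendsto_add_smul _ _
  have h1 := (continuousAt_quot hc hd (isUnit_entire_upperBlock hd hM hN K)).tendsto.comp hlim
  exact ((continuous_dual_apply (φ ∘ₗ LinearMap.fst ℂ V W) ((0 : V), w)).tendsto _).comp h1

theorem eventually_isUnit_entire_add_smul {d : ℕ → ℂ} (hd : ExpBounded d) {M : Module.End ℂ V}
    (hM : IsUnit (entire d M)) (P : Module.End ℂ V) :
    ∀ᶠ t : ℂ in 𝓝 0, IsUnit (entire d (M + t • P)) :=
  (tendsto_add_smul M P).eventually (eventually_isUnit_entire hd hM)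

/-- Since P = (M + tP)t⁻¹ − t⁻¹M, the difference quotient is exactly a divided difference at (M +
tP, M), and the limit is continuity of the latter. -/
theorem hasDerivAt_quot_apply {c d : ℕ → ℂ} (hc : ExpBounded c) (hd : ExpBounded d)
    {M : Module.End ℂ V} (P : Module.End ℂ V) (hM : IsUnit (entire d M)) (φ : Module.Dual ℂ V)
    (v : V) :
    HasDerivAt (fun t : ℂ => φ (quot c d (M + t • P) v)) (φ (dividedDiff c d M M P v)) 0 := by
  rw [hasDerivAt_iff_tendsto_slope_zero]
  have h := (tendsto_dividedDiff hc hd (P := P) (Q := 0) P hM hM φ v).mono_left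
    (nhdsWithin_le_nhds (s := {0}ᶜ))
  refine h.congr' ?_
  filter_upwards [self_mem_nhdsWithin,
    (eventually_isUnit_entire_add_smul hd hM P).filter_mono nhdsWithin_le_nhds] with t ht hu
  have ht : t ≠ 0 := ht
  rw [smul_zero, add_zero, dividedDiff_apply_of_intertwine hc hd hu hM
    (L := t⁻¹ • LinearMap.id) (fun w => by simp [smul_smul, ht])]
  simp [mul_sub]

end Operators

open Filter

/-! ### Residues -/

/-- `g` has residue `c` at `w`, computed with circles of radius tending to zero. -/
def HasRes (g : ℂ → ℂ) (w c : ℂ) : Prop :=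
  (∀ᶠ r in 𝓝[>] (0 : ℝ), CircleIntegrable g w r) ∧
    Tendsto (fun r : ℝ => (2 * Real.pi * Complex.I)⁻¹ * ∮ z in C(w, r), g z) (𝓝[>] 0) (𝓝 c)

theorem HasRes.smallContour_eq {g : ℂ → ℂ} {w c : ℂ} (h : HasRes g w c) :
    GradedRMatrix.smallContour g w = c :=
  h.2.limUnder_eq

theorem HasRes.add {g g' : ℂ → ℂ} {w c c' : ℂ} (h : HasRes g w c) (h' : HasRes g' w c') :
    HasRes (fun z => g z + g' z) w (c + c') := by
  refine ⟨?_, (h.2.add h'.2).congr' ?_⟩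
  · filter_upwards [h.1, h'.1] with r h1 h2 using h1.add h2
  · filter_upwards [h.1, h'.1] with r h1 h2
    rw [circleIntegral.integral_add h1 h2, mul_add]

theorem HasRes.mul_const {g : ℂ → ℂ} {w c : ℂ} (h : HasRes g w c) (a : ℂ) :
    HasRes (fun z => g z * a) w (c * a) := by
  refine ⟨?_, (h.2.mul_const a).congr fun r => ?_⟩
  · filter_upwards [h.1] with r h1
    have := h1.const_smul (a := a)
    simpa [Pi.smul_def, mul_comm] using this
  · simp only [mul_comm _ a, circleIntegral.integral_const_mul]
    ring

theorem eventually_sphere {p : ℂ → Prop} {w : ℂ} (h : ∀ᶠ z in 𝓝[≠] w, p z) :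
    ∀ᶠ r in 𝓝[>] (0 : ℝ), ∀ z ∈ Metric.sphere w r, p z := by
  obtain ⟨ε, hε, h⟩ := Metric.mem_nhdsWithin_iff.1 h
  filter_upwards [Ioo_mem_nhdsGT hε] with r hr z hz
  refine h ⟨?_, ?_⟩
  · rw [Metric.mem_ball, Metric.mem_sphere.1 hz]; exact hr.2
  · rintro rfl
    rw [Metric.mem_sphere, dist_self] at hz
    exact hr.1.ne hz

theorem HasRes.congr {g g' : ℂ → ℂ} {w c : ℂ} (h : HasRes g w c)
    (hgg' : ∀ᶠ z in 𝓝[≠] w, g z = g' z) : HasRes g' w c := by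
  have h0 : ∀ᶠ r in 𝓝[>] (0 : ℝ), 0 < r := self_mem_nhdsWithin
  refine ⟨?_, h.2.congr' ?_⟩
  · filter_upwards [h.1, eventually_sphere hgg', h0] with r h1 h2 hr
    refine (circleIntegrable_congr ?_).1 h1
    rw [abs_of_pos hr]
    exact h2
  · filter_upwards [eventually_sphere hgg', h0] with r h2 hr
    rw [circleIntegral.integral_congr hr.le h2]

theorem eventually_ne_nhdsNE (w u : ℂ) : ∀ᶠ z in 𝓝[≠] w, z ≠ u := by
  rcases eq_or_ne w u with rfl | hw
  · exact self_mem_nhdsWithin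
  · exact nhdsWithin_le_nhds (isOpen_ne.mem_nhds hw)

/-- A bounded integrand contributes O(r) on a circle of radius r. As residues are limits, continuity
suffices and holomorphy is not needed. -/
theorem hasRes_zero_of_continuousAt {g : ℂ → ℂ} {w : ℂ} (h : ∀ᶠ z in 𝓝 w, ContinuousAt g z) :
    HasRes g w 0 := by
  have h0 : ∀ᶠ r in 𝓝[>] (0 : ℝ), 0 < r := self_mem_nhdsWithin
  have hb : ∀ᶠ z in 𝓝 w, ‖g z‖ < ‖g w‖ + 1 :=
    h.self_of_nhds.norm.eventually_lt continuousAt_const (by simp)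
  have hlim : Tendsto (fun r : ℝ => r * (‖g w‖ + 1)) (𝓝[>] 0) (𝓝 0) := by
    have : Continuous fun r : ℝ => r * (‖g w‖ + 1) := by fun_prop
    simpa using (this.tendsto 0).mono_left nhdsWithin_le_nhds
  refine ⟨?_, squeeze_zero_norm' ?_ hlim⟩
  · filter_upwards [eventually_sphere (h.filter_mono nhdsWithin_le_nhds), h0] with r h1 hr
    exact ContinuousOn.circleIntegrable hr.le fun z hz => (h1 z hz).continuousWithinAt
  · filter_upwards [eventually_sphere (hb.filter_mono nhdsWithin_le_nhds), h0] with r h1 hr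
    exact circleIntegral.norm_two_pi_i_inv_smul_integral_le_of_norm_le_const hr.le
      fun z hz => (h1 z hz).le

theorem hasRes_inv_pow (u w : ℂ) (k : ℕ) :
    HasRes (fun z => ((z - u) ^ (k + 1))⁻¹) w (if w = u ∧ k = 0 then 1 else 0) := by
  have h0 : ∀ᶠ r in 𝓝[>] (0 : ℝ), 0 < r := self_mem_nhdsWithin
  by_cases hw : w = u
  · subst hw
    refine ⟨?_, tendsto_nhds_of_eventually_eq ?_⟩
    · filter_upwards [h0] with r hr
      refine ContinuousOn.circleIntegrable hr.le ?_
      refine ContinuousOn.inv₀ (by fun_prop) fun z hz => pow_ne_zero _ (sub_ne_zero.2 ?_)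
      rintro rfl
      rw [Metric.mem_sphere, dist_self] at hz
      exact hr.ne hz
    · filter_upwards [h0] with r hr
      rcases Nat.eq_zero_or_pos k with rfl | hk
      · simp only [zero_add, pow_one, circleIntegral.integral_sub_center_inv w hr.ne', and_self,
          if_true]
        exact inv_mul_cancel₀ (by simp [Real.pi_ne_zero])
      · have h1 := circleIntegral.integral_sub_zpow_of_ne (n := -((k : ℤ) + 1)) (by omega) w w r
        have h2 : (fun z : ℂ => (z - w) ^ (-((k : ℤ) + 1))) = fun z => ((z - w) ^ (k + 1))⁻¹ := by
          ext z
          rw [zpow_neg]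
          norm_cast
        rw [h2] at h1
        simp [h1, hk.ne']
  · rw [if_neg (fun h => hw h.1)]
    refine hasRes_zero_of_continuousAt ?_
    filter_upwards [isOpen_ne.mem_nhds hw] with z hz
    have : z - u ≠ 0 := sub_ne_zero.2 hz
    exact ContinuousAt.inv₀ (by fun_prop) (pow_ne_zero _ this)

theorem HasRes.sum {ι : Type*} (s : Finset ι) {g : ι → ℂ → ℂ} {w : ℂ} {c : ι → ℂ}
    (h : ∀ i ∈ s, HasRes (g i) w (c i)) : HasRes (fun z => ∑ i ∈ s, g i z) w (∑ i ∈ s, c i) := by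
  classical
  induction s using Finset.induction_on with
  | empty => simpa using hasRes_zero_of_continuousAt (g := fun _ => 0) (w := w) (by simp [continuousAt_const])
  | insert i s hi ih =>
    simp only [Finset.sum_insert hi]
    exact (h i (Finset.mem_insert_self i s)).add
      (ih fun j hj => h j (Finset.mem_insert_of_mem hj))

/-! ### The resolvent -/

section Resolvent

variable {V : Type*} [AddCommGroup V] [Module ℂ V]

theorem resolvent_apply_sub {M : Module.End ℂ V} {z : ℂ} (hz : z ∉ spectrum ℂ M) (v : V) :
    resolvent M z (z • v - M v) = v := by
  have h := spectrum.notMem_iff.1 hz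
  have h1 : z • v - M v = (algebraMap ℂ (Module.End ℂ V) z - M) v := by simp
  rw [resolvent, h1, ← Module.End.mul_apply, Ring.inverse_mul_cancel _ h, Module.End.one_apply]

theorem sub_apply_resolvent {M : Module.End ℂ V} {z : ℂ} (hz : z ∉ spectrum ℂ M) (v : V) :
    z • resolvent M z v - M (resolvent M z v) = v := by
  have h := spectrum.notMem_iff.1 hz
  have h1 : z • resolvent M z v - M (resolvent M z v) =
    (algebraMap ℂ (Module.End ℂ V) z - M) (resolvent M z v) := by simp
  rw [resolvent] at h1 ⊢
  rw [h1, ← Module.End.mul_apply, Ring.mul_inverse_cancel _ h, Module.End.one_apply]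

/-- On a generalised eigenvector the Neumann series around μ terminates; applying z − M to it
telescopes. -/
theorem resolvent_apply_of_pow_eq_zero {M : Module.End ℂ V} {μ z : ℂ} (hz : z ∉ spectrum ℂ M)
    (hzμ : z ≠ μ) {k : ℕ} {v : V} (hv : ((M - μ • (1 : Module.End ℂ V)) ^ k) v = 0) :
    resolvent M z v =
      ∑ j ∈ Finset.range k, ((z - μ) ^ (j + 1))⁻¹ • ((M - μ • (1 : Module.End ℂ V)) ^ j) v := by
  have hzμ' : z - μ ≠ 0 := sub_ne_zero.2 hzμ
  rw [← resolvent_apply_sub hz (∑ j ∈ Finset.range k, ((z - μ) ^ (j + 1))⁻¹ •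
    ((M - μ • (1 : Module.End ℂ V)) ^ j) v)]
  congr 1
  set B := M - μ • (1 : Module.End ℂ V) with hB
  have hM : ∀ u, z • u - M u = (z - μ) • u - B u := by
    intro u
    simp only [hB, LinearMap.sub_apply, LinearMap.smul_apply, Module.End.one_apply, sub_smul]
    abel
  rw [hM, map_sum, Finset.smul_sum, ← Finset.sum_sub_distrib]
  have hterm : ∀ j ∈ Finset.range k,
      (z - μ) • ((z - μ) ^ (j + 1))⁻¹ • (B ^ j) v - B (((z - μ) ^ (j + 1))⁻¹ • (B ^ j) v) =
      ((z - μ) ^ j)⁻¹ • (B ^ j) v - ((z - μ) ^ (j + 1))⁻¹ • (B ^ (j + 1)) v := by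
    intro j _
    rw [map_smul, pow_succ' B, Module.End.mul_apply, smul_smul]
    congr 2
    rw [pow_succ, mul_inv, mul_comm, mul_assoc, inv_mul_cancel₀ hzμ', mul_one]
  rw [Finset.sum_congr rfl hterm, Finset.sum_range_sub' (fun j => ((z - μ) ^ j)⁻¹ • (B ^ j) v)]
  simp [hv]

variable [FiniteDimensional ℂ V]

theorem eventually_notMem_spectrum (M : Module.End ℂ V) (w : ℂ) :
    ∀ᶠ z in 𝓝[≠] w, z ∉ spectrum ℂ M := by
  have h1 : ((spectrum ℂ M) \ {w})ᶜ ∈ 𝓝 w :=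
    ((Module.End.finite_spectrum M).subset Set.sdiff_subset).isClosed.isOpen_compl.mem_nhds (by simp)
  filter_upwards [nhdsWithin_le_nhds h1, self_mem_nhdsWithin] with z hz hzw hzs
  exact hz ⟨hzs, hzw⟩

/-- The residues of the resolvent sum up to the identity. -/
theorem exists_hasRes_resolvent (M : Module.End ℂ V) (v : V) (φ : Module.Dual ℂ V) :
    ∃ c : ℂ → ℂ, (∀ w, HasRes (fun z => φ (resolvent M z v)) w (c w)) ∧
      ∑ w ∈ (Module.End.finite_spectrum M).toFinset, c w = φ v := by
  classical
  have hv : v ∈ ⨆ μ, M.maxGenEigenspace μ := by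
    rw [Module.End.iSup_maxGenEigenspace_eq_top]; trivial
  refine Submodule.iSup_induction _ (motive := fun v => ∃ c : ℂ → ℂ,
    (∀ w, HasRes (fun z => φ (resolvent M z v)) w (c w)) ∧
      ∑ w ∈ (Module.End.finite_spectrum M).toFinset, c w = φ v) hv ?_ ?_ ?_
  · intro μ v hv
    obtain ⟨k, hk⟩ := (Module.End.mem_maxGenEigenspace M μ v).1 hv
    -- In the finite Laurent expansion only the term j = 0, a simple pole at μ, has a residue.
    refine ⟨fun w => if w = μ then φ v else 0, fun w => ?_, ?_⟩
    · have h := HasRes.sum (Finset.range k) (w := w) fun j _ => (hasRes_inv_pow μ w j).mul_const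
        (φ (((M - μ • (1 : Module.End ℂ V)) ^ j) v))
      have hc : (∑ j ∈ Finset.range k, (if w = μ ∧ j = 0 then (1 : ℂ) else 0) *
          φ (((M - μ • (1 : Module.End ℂ V)) ^ j) v)) = if w = μ then φ v else 0 := by
        by_cases hw : w = μ
        · cases k with
          | zero => simp at hk; simp [hk]
          | succ k => simp [hw]
        · simp [hw]
      rw [hc] at h
      refine h.congr ?_
      filter_upwards [eventually_notMem_spectrum M w,
        eventually_ne_nhdsNE w μ] with z hz hzμ
      rw [resolvent_apply_of_pow_eq_zero hz hzμ hk]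
      simp
    · rw [Finset.sum_ite_eq']
      split_ifs with h
      · rfl
      -- Outside the spectrum the generalised eigenspace is zero, so the missing summand is zero
      -- too.
      · have hev : ¬ M.HasEigenvalue μ := fun h' => h (by
          simpa using h'.mem_spectrum)
        have : v = 0 := by
          by_contra hv0
          refine hev (Module.End.hasEigenvalue_of_hasGenEigenvalue (k := k) ?_)
          refine Submodule.ne_bot_iff _ |>.2 ⟨v, ?_, hv0⟩
          rw [Module.End.mem_genEigenspace_nat]
          simpa using hk
        simp [this]
  · exact ⟨fun _ => 0, fun w => by
      simpa using hasRes_zero_of_continuousAt (g := fun _ => 0) (w := w)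
        (by simp [continuousAt_const]), by simp⟩
  · intro x y hx hy
    obtain ⟨a, ha, ha'⟩ := hx
    obtain ⟨b, hb, hb'⟩ := hy
    refine ⟨fun w => a w + b w, fun w => ?_, ?_⟩
    · simpa using (ha w).add (hb w)
    · rw [Finset.sum_add_distrib, ha', hb', map_add]

end Resolvent

/-! ### Comparison with the contour integral -/

section Contour

variable {V : Type*} [AddCommGroup V] [Module ℂ V] [FiniteDimensional ℂ V]

attribute [local instance] endNormedRing endNormedAlgebra

theorem isUnit_entire_smul_one {d : ℕ → ℂ} (hd : ExpBounded d) {z : ℂ} (hz : entire d z ≠ 0) :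
    IsUnit (entire d (z • (1 : Module.End ℂ V))) := by
  rw [isUnit_entire_iff hd]
  intro μ hμ
  obtain ⟨v, hv⟩ := hμ.exists_hasEigenvector
  have h : z • v = μ • v := by simpa using hv.apply_eq_smul
  rwa [← smul_left_injective ℂ hv.2 h]

/-- The value of `H = c / d` at `M` as a contour integral. -/
theorem holCalc_eq_quot {c d : ℕ → ℂ} (hc : ExpBounded c) (hd : ExpBounded d) {H : ℂ → ℂ}
    (hH : ∀ w, entire d w ≠ 0 → ∀ᶠ z in 𝓝[≠] w, H z = entire c z / entire d z)
    {M : Module.End ℂ V} (hM : IsUnit (entire d M)) :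
    GradedRMatrix.holCalc H M = quot c d M := by
  set b := Module.finBasis ℂ V with hb
  rw [← LinearMap.toMatrix b b |>.injective.eq_iff]
  rw [GradedRMatrix.holCalc, LinearMap.toMatrix_toLin]
  ext i j
  rw [Matrix.of_apply, LinearMap.toMatrix_apply]
  obtain ⟨r, hr, hr'⟩ := exists_hasRes_resolvent M (b j) (b.coord i ∘ₗ quot c d M)
  change _ = (b.coord i ∘ₗ quot c d M) (b j)
  rw [← hr']
  refine Finset.sum_congr rfl fun w hw => HasRes.smallContour_eq ?_
  have hw' : entire d w ≠ 0 := by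
    refine (isUnit_entire_iff hd).1 hM w ?_
    rw [Module.End.hasEigenvalue_iff_mem_spectrum]
    simpa using hw
  -- With q = c/d, off the spectrum ψ is an entry of (q(z) − q(M))(z − M)⁻¹. As a divided difference
  -- it extends continuously across w, so its residue is 0, and q(M)(z − M)⁻¹ carries the whole
  -- residue.
  set ψ : ℂ → ℂ := fun z => b.coord i (dividedDiff c d (z • (1 : Module.End ℂ V)) M 1 (b j)) with hψ
  have hne : ∀ᶠ z in 𝓝 w, entire d z ≠ 0 :=
    hd.continuous.continuousAt.eventually_ne hw'
  have hψ0 : HasRes ψ w 0 := by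
    refine hasRes_zero_of_continuousAt ?_
    filter_upwards [hne] with z hz
    have h := tendsto_dividedDiff hc hd (P := 1) (Q := 0) 1 (isUnit_entire_smul_one hd hz) hM
      (b.coord i) (b j)
    have h1 : Tendsto (fun x : ℂ => x - z) (𝓝 z) (𝓝 0) := by
      simpa using (continuous_id.sub continuous_const).tendsto (x := z) (f := fun x : ℂ => x - z)
    refine (h.comp h1).congr fun x => ?_
    simp only [Function.comp_apply, hψ, ← add_smul, add_sub_cancel, smul_zero, add_zero]
  have := hψ0.add (hr w)
  rw [zero_add] at this
  refine this.congr ?_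
  filter_upwards [hH w hw', hne.filter_mono nhdsWithin_le_nhds,
    eventually_notMem_spectrum M w] with z hz hz0 hzM
  have hu := isUnit_entire_smul_one (V := V) hd hz0
  have h1 := dividedDiff_apply_of_intertwine hc hd hu hM (K := 1) (L := resolvent M z) (fun v => by
    rw [Module.End.one_apply]
    conv_lhs => rw [← resolvent_apply_sub hzM v]
    simp) (b j)
  have h2 : ∀ v, resolvent M z (M v) = M (resolvent M z v) := by
    intro v
    have h3 := resolvent_apply_sub hzM v
    have h4 := sub_apply_resolvent hzM v
    rw [map_sub, map_smul] at h3
    exact sub_right_injective (h3.trans h4.symm)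
  have h3 := quot_intertwine hc hd hM hM (T := resolvent M z) h2 (b j)
  have h4 := quot_apply_of_eigenvector hc hd hu hz0 (v := resolvent M z (b j)) (by simp)
  simp only [hψ]
  rw [h1, h3, h4, LinearMap.toMatrix_apply, hz, map_sub, map_smul, LinearMap.comp_apply,
    sub_add_cancel, smul_eq_mul]
  rfl

end Contour

/-! ### Power series of hyperbolic functions -/

/-- The coefficients of `exp z`. -/
noncomputable def expCoeff (k : ℕ) : ℂ := (k.factorial : ℂ)⁻¹

/-- The coefficients of `½ cosh (z / 2)`. -/
noncomputable def coshCoeff (k : ℕ) : ℂ :=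
  (1 / 4) * ((1 / 2) ^ k * (k.factorial : ℂ)⁻¹ + (-1 / 2) ^ k * (k.factorial : ℂ)⁻¹)

/-- The coefficients of `sinh (z / 2)`. -/
noncomputable def sinhCoeff (k : ℕ) : ℂ :=
  (1 / 2) * ((1 / 2) ^ k * (k.factorial : ℂ)⁻¹ - (-1 / 2) ^ k * (k.factorial : ℂ)⁻¹)

/-- The coefficients of `z⁻¹ sinh (z / 2)`. -/
noncomputable def sinhDivCoeff (k : ℕ) : ℂ := sinhCoeff (k + 1)

/-- The coefficients of `z⁻¹ (½ cosh (z / 2) - z⁻¹ sinh (z / 2))`. -/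
noncomputable def coshSubCoeff (k : ℕ) : ℂ := coshCoeff (k + 1) - sinhDivCoeff (k + 1)

theorem expBounded_expCoeff : ExpBounded expCoeff :=
  ⟨1, zero_le_one, fun k => by simp [expCoeff]⟩

theorem norm_half_pow_mul_le {s : ℂ} (hs : ‖s‖ ≤ 1) (k : ℕ) :
    ‖s ^ k * (k.factorial : ℂ)⁻¹‖ ≤ (k.factorial : ℝ)⁻¹ := by
  rw [norm_mul, norm_pow, norm_inv, Complex.norm_natCast]
  exact mul_le_of_le_one_left (by positivity) (pow_le_one₀ (norm_nonneg _) hs)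

theorem expBounded_coshCoeff : ExpBounded coshCoeff := by
  refine ⟨1, zero_le_one, fun k => ?_⟩
  have h1 := norm_half_pow_mul_le (s := 1 / 2) (by norm_num) k
  have h2 := norm_half_pow_mul_le (s := -1 / 2) (by norm_num) k
  have h3 := norm_add_le ((1 / 2 : ℂ) ^ k * (k.factorial : ℂ)⁻¹)
    ((-1 / 2 : ℂ) ^ k * (k.factorial : ℂ)⁻¹)
  have h4 : ‖(1 / 4 : ℂ)‖ = 1 / 4 := by norm_num
  rw [coshCoeff, norm_mul, h4]
  have h5 : (0 : ℝ) ≤ (k.factorial : ℝ)⁻¹ := by positivity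
  linarith

theorem expBounded_sinhCoeff : ExpBounded sinhCoeff := by
  refine ⟨1, zero_le_one, fun k => ?_⟩
  have h1 := norm_half_pow_mul_le (s := 1 / 2) (by norm_num) k
  have h2 := norm_half_pow_mul_le (s := -1 / 2) (by norm_num) k
  have h3 := norm_sub_le ((1 / 2 : ℂ) ^ k * (k.factorial : ℂ)⁻¹)
    ((-1 / 2 : ℂ) ^ k * (k.factorial : ℂ)⁻¹)
  have h4 : ‖(1 / 2 : ℂ)‖ = 1 / 2 := by norm_num
  rw [sinhCoeff, norm_mul, h4]
  linarith

theorem expBounded_sinhDivCoeff : ExpBounded sinhDivCoeff := expBounded_sinhCoeff.shift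

theorem expBounded_coshSubCoeff : ExpBounded coshSubCoeff :=
  expBounded_coshCoeff.shift.sub expBounded_sinhDivCoeff.shift

section Banach

variable {E : Type*} [NormedRing E] [NormedAlgebra ℂ E]

theorem entire_neg_of_parity {c : ℕ → ℂ} {s : ℂ} (hs : ∀ k, (-1) ^ k * c k = s * c k) (a : E) :
    entire c (-a) = s • entire c a := by
  rw [entire, entire, ← tsum_const_smul'' s]
  congr 1
  ext k
  rw [← neg_one_smul ℂ a, smul_pow, smul_smul, smul_smul, mul_comm, hs]

theorem entire_expCoeff (a : E) : entire expCoeff a = NormedSpace.exp a := by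
  rw [NormedSpace.exp_eq_tsum ℂ]
  rfl

variable [CompleteSpace E]

theorem hasSum_exp_smul (s : ℂ) (a : E) :
    HasSum (fun k : ℕ => (s ^ k * (k.factorial : ℂ)⁻¹) • a ^ k) (NormedSpace.exp (s • a)) := by
  have := expBounded_expCoeff.hasSum (s • a)
  rw [entire_expCoeff] at this
  simpa [expCoeff, smul_pow, smul_smul, mul_comm] using this

theorem entire_coshCoeff (a : E) : entire coshCoeff a =
    (1 / 4 : ℂ) • (NormedSpace.exp ((1 / 2 : ℂ) • a) + NormedSpace.exp ((-1 / 2 : ℂ) • a)) := by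
  refine (expBounded_coshCoeff.hasSum a).unique ?_
  simpa only [coshCoeff, mul_smul, add_smul] using
    ((hasSum_exp_smul (1 / 2) a).add (hasSum_exp_smul (-1 / 2) a)).const_smul (1 / 4 : ℂ)

theorem entire_sinhCoeff (a : E) : entire sinhCoeff a =
    (1 / 2 : ℂ) • (NormedSpace.exp ((1 / 2 : ℂ) • a) - NormedSpace.exp ((-1 / 2 : ℂ) • a)) := by
  refine (expBounded_sinhCoeff.hasSum a).unique ?_
  simpa only [sinhCoeff, mul_smul, sub_smul] using
    ((hasSum_exp_smul (1 / 2) a).sub (hasSum_exp_smul (-1 / 2) a)).const_smul (1 / 2 : ℂ)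

theorem entire_sinhCoeff_eq_mul (a : E) : entire sinhCoeff a = a * entire sinhDivCoeff a := by
  rw [entire_eq_add_mul_shift expBounded_sinhCoeff]
  simp only [sinhCoeff, pow_zero, sub_self, mul_zero, zero_smul, zero_add]
  rfl

theorem entire_coshCoeff_eq_add (a : E) :
    entire coshCoeff a = entire sinhDivCoeff a + a * entire coshSubCoeff a := by
  have h1 : entire coshSubCoeff a =
      entire (fun k => coshCoeff (k + 1)) a - entire (fun k => sinhDivCoeff (k + 1)) a :=
    entire_sub expBounded_coshCoeff.shift expBounded_sinhDivCoeff.shift a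
  -- Equal constant terms (both ½) make the difference divisible by z: the singularity of f at 0 is
  -- removable.
  have h2 : coshCoeff 0 = sinhDivCoeff 0 := by norm_num [coshCoeff, sinhDivCoeff, sinhCoeff]
  rw [entire_eq_add_mul_shift expBounded_coshCoeff, entire_eq_add_mul_shift expBounded_sinhDivCoeff,
    h1, h2, mul_sub]
  abel

end Banach

theorem entire_coshCoeff_complex (z : ℂ) : entire coshCoeff z = (1 / 2) * Complex.cosh (z / 2) := by
  rw [entire_coshCoeff, ← Complex.exp_eq_exp_ℂ, Complex.cosh]
  simp only [smul_eq_mul]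
  ring_nf

theorem entire_sinhCoeff_complex (z : ℂ) : entire sinhCoeff z = Complex.sinh (z / 2) := by
  rw [entire_sinhCoeff, ← Complex.exp_eq_exp_ℂ, Complex.sinh]
  simp only [smul_eq_mul]
  ring_nf

theorem coefF_eq (z : ℂ) :
    GradedRMatrix.coefF z = entire coshCoeff z / entire sinhCoeff z := by
  rw [GradedRMatrix.coefF, entire_coshCoeff_complex, entire_sinhCoeff_complex]
  ring

theorem coeff_eq {z : ℂ} (hz : z ≠ 0) (hd : entire sinhDivCoeff z ≠ 0) :
    GradedRMatrix.coeff z = entire coshSubCoeff z / entire sinhDivCoeff z := by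
  have h : GradedRMatrix.coeff z = GradedRMatrix.coefF z - 1 / z := rfl
  rw [h, coefF_eq, entire_coshCoeff_eq_add, entire_sinhCoeff_eq_mul]
  field_simp
  ring

theorem exists_int_of_entire_sinhCoeff_eq_zero {z : ℂ} (hz : entire sinhCoeff z = 0) :
    ∃ k : ℤ, z = 2 * Real.pi * Complex.I * k := by
  rw [entire_sinhCoeff_complex] at hz
  have h : Complex.sin (z / 2 * Complex.I) = 0 := by rw [Complex.sin_mul_I, hz, zero_mul]
  obtain ⟨k, hk⟩ := Complex.sin_eq_zero_iff.1 h
  refine ⟨-k, ?_⟩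
  push_cast
  linear_combination (-2 * Complex.I) * hk + z * Complex.I_sq

theorem entire_sinhDivCoeff_zero : entire sinhDivCoeff (0 : ℂ) ≠ 0 := by
  rw [entire_eq_add_mul_shift expBounded_sinhDivCoeff]
  norm_num [sinhDivCoeff, sinhCoeff]

/-! ### The addition theorem for derivations -/

section Operators

attribute [local instance] endNormedRing endNormedAlgebra

variable {V : Type*} [AddCommGroup V] [Module ℂ V] [FiniteDimensional ℂ V]
variable {W : Type*} [AddCommGroup W] [Module ℂ W] [FiniteDimensional ℂ W]
variable {U : Type*} [AddCommGroup U] [Module ℂ U] [FiniteDimensional ℂ U]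

theorem isUnit_entire_neg_of_parity {d : ℕ → ℂ} {s : ℂ} (hs : ∀ k, (-1) ^ k * d k = s * d k)
    (hs0 : s ≠ 0) {M : Module.End ℂ V} (hM : IsUnit (entire d M)) :
    IsUnit (entire d (-M)) := by
  rw [entire_neg_of_parity hs]
  exact hM.smul (Units.mk0 s hs0)

theorem quot_neg_of_parity {c d : ℕ → ℂ} {s : ℂ} (hs : s ≠ 0) (hc : ∀ k, (-1) ^ k * c k = -s * c k)
    (hd : ∀ k, (-1) ^ k * d k = s * d k) {M : Module.End ℂ V} (hM : IsUnit (entire d M)) :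
    quot c d (-M) = -quot c d M := by
  have hM' := isUnit_entire_neg_of_parity hd hs hM
  ext v
  obtain ⟨u, rfl⟩ := exists_entire_apply_eq hM' v
  rw [quot_apply_entire hM', LinearMap.neg_apply, entire_neg_of_parity hc, entire_neg_of_parity hd,
    LinearMap.smul_apply, LinearMap.smul_apply, map_smul, quot_apply_entire hM, neg_smul]

-- On V ⊗ W the operators M ⊗ 1 and 1 ⊗ N commute, so the exponential of their sum factors; the
-- linear map induced by β intertwines that sum with D.
open TensorProduct in
theorem exp_apply_bilin (β : V →ₗ[ℂ] W →ₗ[ℂ] U) {M : Module.End ℂ V} {N : Module.End ℂ W}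
    {D : Module.End ℂ U} (h : ∀ v w, D (β v w) = β (M v) w + β v (N w)) (v : V) (w : W) :
    NormedSpace.exp D (β v w) = β (NormedSpace.exp M v) (NormedSpace.exp N w) := by
  let : NormedAlgebra ℚ (Module.End ℂ (V ⊗[ℂ] W)) := NormedAlgebra.restrictScalars ℚ ℂ _
  have hcomm : Commute (LinearMap.rTensor W M) (LinearMap.lTensor V N) := by
    refine TensorProduct.ext' fun v w => ?_
    simp
  have h1 := entire_intertwine expBounded_expCoeff (T := TensorProduct.lift β)
    (M := LinearMap.rTensor W M + LinearMap.lTensor V N) (N := D) (by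
      intro x
      induction x using TensorProduct.induction_on with
      | zero => simp
      | tmul x y => simp [h]
      | add x y hx hy => rw [map_add, map_add, hx, hy, map_add, map_add]) (v ⊗ₜ w)
  have h2 := entire_intertwine expBounded_expCoeff (T := (TensorProduct.mk ℂ V W).flip
    (NormedSpace.exp N w)) (M := M) (N := LinearMap.rTensor W M) (fun x => by simp) v
  have h3 := entire_intertwine expBounded_expCoeff (T := TensorProduct.mk ℂ V W v)
    (M := N) (N := LinearMap.lTensor V N) (fun x => by simp) w
  simp only [entire_expCoeff, TensorProduct.mk_apply, LinearMap.flip_apply,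
    TensorProduct.lift.tmul] at h1 h2 h3
  rw [← h1, NormedSpace.exp_add_of_commute hcomm, Module.End.mul_apply, ← h3, ← h2,
    TensorProduct.lift.tmul]

/-- The addition theorem of `½ coth (z / 2)`, evaluated on a pairing satisfying the Leibniz rule. -/
theorem coth_addition (β : V →ₗ[ℂ] W →ₗ[ℂ] U) {M : Module.End ℂ V} {N : Module.End ℂ W}
    {D : Module.End ℂ U} (h : ∀ v w, D (β v w) = β (M v) w + β v (N w))
    (hM : IsUnit (entire sinhCoeff M)) (hN : IsUnit (entire sinhCoeff N))
    (hD : IsUnit (entire sinhCoeff D)) (v : V) (w : W) :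
    β (quot coshCoeff sinhCoeff M v) (quot coshCoeff sinhCoeff N w) -
      quot coshCoeff sinhCoeff D
        (β v (quot coshCoeff sinhCoeff N w) + β (quot coshCoeff sinhCoeff M v) w) =
      -(1 / 4 : ℂ) • β v w := by
  -- Clearing denominators leaves the addition theorems of sinh (`h1`) and cosh (`h2`). The
  -- constants are uneven because `coshCoeff` already contains the factor ½.
  obtain ⟨x, rfl⟩ := exists_entire_apply_eq hM v
  obtain ⟨y, rfl⟩ := exists_entire_apply_eq hN w
  have hp := exp_apply_bilin β (M := (1 / 2 : ℂ) • M) (N := (1 / 2 : ℂ) • N)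
    (D := (1 / 2 : ℂ) • D) (fun v w => by simp [h]) x y
  have hm := exp_apply_bilin β (M := (-1 / 2 : ℂ) • M) (N := (-1 / 2 : ℂ) • N)
    (D := (-1 / 2 : ℂ) • D) (fun v w => by simp [h]) x y
  have h1 : β (entire sinhCoeff M x) (entire coshCoeff N y) +
      β (entire coshCoeff M x) (entire sinhCoeff N y) =
      (1 / 2 : ℂ) • entire sinhCoeff D (β x y) := by
    simp only [entire_sinhCoeff, entire_coshCoeff, LinearMap.smul_apply, LinearMap.add_apply,
      LinearMap.sub_apply, map_smul, map_add, map_sub, hp, hm]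
    module
  have h2 : β (entire coshCoeff M x) (entire coshCoeff N y) =
      (1 / 2 : ℂ) • entire coshCoeff D (β x y) -
        (1 / 4 : ℂ) • β (entire sinhCoeff M x) (entire sinhCoeff N y) := by
    simp only [entire_sinhCoeff, entire_coshCoeff, LinearMap.smul_apply, LinearMap.add_apply,
      LinearMap.sub_apply, map_smul, map_add, map_sub, hp, hm]
    module
  rw [quot_apply_entire hM, quot_apply_entire hN, h1, h2, map_smul, quot_apply_entire hD]
  module

end Operators

end FinDimCalculus

namespace GradedRMatrix

open Filter FinDimCalculus

/-! ### Operators and brackets on the graded pieces -/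

section Pieces

variable {Z : Type*} [AddCommGroup Z] [DecidableEq Z]
variable {A : Type*} [LieRing A] [LieAlgebra ℂ A]
variable {𝒜 : Z → Submodule ℂ A} [GradedLieAlgebra 𝒜]

@[simp]
theorem coe_adPiece (κ : 𝒜 0) (n : Z) (x : 𝒜 n) : (adPiece 𝒜 κ n x : A) = ⁅(κ : A), (x : A)⁆ := rfl

theorem adPiece_add (κ T : 𝒜 0) (n : Z) : adPiece 𝒜 (κ + T) n = adPiece 𝒜 κ n + adPiece 𝒜 T n := by
  ext x
  simp

theorem adPiece_smul (t : ℂ) (T : 𝒜 0) (n : Z) : adPiece 𝒜 (t • T) n = t • adPiece 𝒜 T n := by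
  ext x
  simp

/-- The operator on `A` with prescribed restrictions to the graded pieces. -/
noncomputable def gradedOp (S : ∀ n, Module.End ℂ (𝒜 n)) : Module.End ℂ A :=
  DirectSum.coeLinearMap 𝒜 ∘ₗ DirectSum.lmap S ∘ₗ (DirectSum.decomposeLinearEquiv 𝒜).toLinearMap

@[simp]
theorem gradedOp_apply (S : ∀ n, Module.End ℂ (𝒜 n)) {n : Z} (x : 𝒜 n) :
    gradedOp S (x : A) = S n x := by
  simp [gradedOp]

theorem linearMap_ext_homogeneous {N : Type*} [AddCommGroup N] [Module ℂ N] {f g : A →ₗ[ℂ] N}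
    (h : ∀ (n : Z) (x : 𝒜 n), f x = g x) : f = g := by
  ext x
  induction x using DirectSum.Decomposition.inductionOn 𝒜 with
  | zero => simp
  | homogeneous x => exact h _ x
  | add a b ha hb => rw [map_add, map_add, ha, hb]

/-- The bracket `A_m × A_n → A_k`, where `k = m + n`. -/
def pieceBracket {m n k : Z} (h : m + n = k) : 𝒜 m →ₗ[ℂ] 𝒜 n →ₗ[ℂ] 𝒜 k :=
  LinearMap.mk₂ ℂ (fun x y => ⟨⁅(x : A), (y : A)⁆,
      h ▸ SetLike.GradedBracket.bracket_mem (ℒ := 𝒜) x.2 y.2⟩)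
    (fun _ _ _ => Subtype.ext (by simp)) (fun _ _ _ => Subtype.ext (by simp))
    (fun _ _ _ => Subtype.ext (by simp)) (fun _ _ _ => Subtype.ext (by simp))

@[simp]
theorem coe_pieceBracket {m n k : Z} (h : m + n = k) (x : 𝒜 m) (y : 𝒜 n) :
    (pieceBracket h x y : A) = ⁅(x : A), (y : A)⁆ := rfl

/-- Scalar shifts add along the bracket, so ad κ can be moved off the poles of coth without losing
the Leibniz rule. -/
theorem pieceBracket_leibniz {m n k : Z} (h : m + n = k) (κ : 𝒜 0) (s t : ℂ) (x : 𝒜 m) (y : 𝒜 n) :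
    (adPiece 𝒜 κ k + (s + t) • (1 : Module.End ℂ (𝒜 k))) (pieceBracket h x y) =
      pieceBracket h ((adPiece 𝒜 κ m + s • (1 : Module.End ℂ (𝒜 m))) x) y +
        pieceBracket h x ((adPiece 𝒜 κ n + t • (1 : Module.End ℂ (𝒜 n))) y) := by
  apply Subtype.ext
  simp only [LinearMap.add_apply, LinearMap.smul_apply, Module.End.one_apply, map_add, map_smul,
    Submodule.coe_add, Submodule.coe_smul, coe_adPiece, coe_pieceBracket]
  rw [leibniz_lie (κ : A) (x : A) (y : A)]
  module

/-! ### The functional calculus on the graded pieces -/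

/-- The numerator of the function defining the `r`-matrix on `A_n`. -/
noncomputable def numCoeff (n : Z) : ℕ → ℂ := if n = 0 then coshSubCoeff else coshCoeff

/-- The denominator of the function defining the `r`-matrix on `A_n`. -/
noncomputable def denCoeff (n : Z) : ℕ → ℂ := if n = 0 then sinhDivCoeff else sinhCoeff

theorem expBounded_numCoeff (n : Z) : ExpBounded (numCoeff n) := by
  rw [numCoeff]
  split_ifs
  exacts [expBounded_coshSubCoeff, expBounded_coshCoeff]

theorem expBounded_denCoeff (n : Z) : ExpBounded (denCoeff n) := by
  rw [denCoeff]
  split_ifs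
  exacts [expBounded_sinhDivCoeff, expBounded_sinhCoeff]

variable [∀ n, FiniteDimensional ℂ (𝒜 n)]

attribute [local instance] endNormedRing endNormedAlgebra

/-- The denominators of the `r`-matrix are invertible at `κ`. -/
def IsRegular (κ : 𝒜 0) : Prop := ∀ n : Z, IsUnit (entire (denCoeff n) (adPiece 𝒜 κ n))

theorem SpectralCondition.isRegular {κ : 𝒜 0} (h : SpectralCondition 𝒜 κ) : IsRegular κ := by
  intro n
  rw [isUnit_entire_iff (expBounded_denCoeff n)]
  intro μ hμ h0
  have hμ' := hμ.mem_spectrum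
  by_cases hn : n = 0
  · subst hn
    rw [denCoeff, if_pos rfl] at h0
    have h1 : entire sinhCoeff μ = 0 := by rw [entire_sinhCoeff_eq_mul, h0, mul_zero]
    obtain ⟨k, rfl⟩ := exists_int_of_entire_sinhCoeff_eq_zero h1
    refine h.2 k ?_ hμ'
    -- The eigenvalue 0 is allowed on A_0, where the denominator z⁻¹ sinh(z/2) takes the value ½.
    rintro rfl
    rw [Int.cast_zero, mul_zero] at h0
    exact entire_sinhDivCoeff_zero h0
  · rw [denCoeff, if_neg hn] at h0
    obtain ⟨k, rfl⟩ := exists_int_of_entire_sinhCoeff_eq_zero h0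
    exact h.1 n hn k hμ'

theorem holCalc_adPiece {κ : 𝒜 0} {n : Z} (h : IsUnit (entire (denCoeff n) (adPiece 𝒜 κ n))) :
    holCalc (if n = 0 then coeff else coefF) (adPiece 𝒜 κ n) =
      quot (numCoeff n) (denCoeff n) (adPiece 𝒜 κ n) := by
  refine holCalc_eq_quot (expBounded_numCoeff n) (expBounded_denCoeff n) (fun w hw => ?_) h
  by_cases hn : n = 0
  · simp only [hn, numCoeff, denCoeff, if_true] at hw ⊢
    filter_upwards [(expBounded_sinhDivCoeff.continuous.continuousAt.eventually_ne hw).filter_mono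
      nhdsWithin_le_nhds, eventually_ne_nhdsNE w 0] with z h1 h2
    exact coeff_eq h2 h1
  · simp only [hn, numCoeff, denCoeff, if_false]
    exact Eventually.of_forall coefF_eq

/-! ### The r-matrix as a quotient of power series, and its derivative -/

/-- The value at `(ad κ)_n + z` of the function defining the `r`-matrix on `A_n`. -/
noncomputable def shiftedR (κ : 𝒜 0) (n : Z) (z : ℂ) : Module.End ℂ (𝒜 n) :=
  quot (numCoeff n) (denCoeff n) (adPiece 𝒜 κ n + z • 1)

theorem rMatrix_apply {κ : 𝒜 0} (hκ : IsRegular κ) {n : Z} (x : 𝒜 n) :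
    rMatrix 𝒜 κ (x : A) = shiftedR κ n 0 x := by
  have h := gradedOp_apply
    (fun n => holCalc (if n = 0 then coeff else coefF) (adPiece 𝒜 κ n)) x
  rw [holCalc_adPiece (hκ n)] at h
  rw [shiftedR, zero_smul, add_zero, ← h]
  rfl

/-- The derivative of the `r`-matrix. -/
noncomputable def rDeriv {κ : 𝒜 0} (hκ : IsRegular κ) : 𝒜 0 →ₗ[ℂ] Module.End ℂ A where
  toFun T := gradedOp fun n => dividedDiff (numCoeff n) (denCoeff n) (adPiece 𝒜 κ n)
    (adPiece 𝒜 κ n) (adPiece 𝒜 T n)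
  map_add' S T := linearMap_ext_homogeneous (𝒜 := 𝒜) fun n x => by
    simp [adPiece_add,
      dividedDiff_add (expBounded_numCoeff n) (expBounded_denCoeff n) (hκ n) (hκ n)]
  map_smul' t T := linearMap_ext_homogeneous (𝒜 := 𝒜) fun n x => by
    simp [adPiece_smul,
      dividedDiff_smul (expBounded_numCoeff n) (expBounded_denCoeff n) (hκ n) (hκ n)]

theorem rDeriv_apply {κ : 𝒜 0} (hκ : IsRegular κ) (T : 𝒜 0) {n : Z} (x : 𝒜 n) :
    rDeriv hκ T (x : A) = dividedDiff (numCoeff n) (denCoeff n) (adPiece 𝒜 κ n)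
      (adPiece 𝒜 κ n) (adPiece 𝒜 T n) x :=
  gradedOp_apply _ x

theorem hasDirDeriv_rMatrix {κ : 𝒜 0} (hκ : IsRegular κ) (T : 𝒜 0) :
    HasDirDeriv (rMatrix 𝒜) κ T (rDeriv hκ T) := by
  intro Y φ
  induction Y using DirectSum.Decomposition.inductionOn 𝒜 with
  | zero => simpa using hasDerivAt_const (0 : ℂ) (0 : ℂ)
  | @homogeneous n x =>
    have h := hasDerivAt_quot_apply (expBounded_numCoeff n) (expBounded_denCoeff n)
      (adPiece 𝒜 T n) (hκ n) (φ ∘ₗ (𝒜 n).subtype) x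
    rw [rDeriv_apply]
    refine h.congr_of_eventuallyEq ?_
    -- How small t must be may depend on n, so the quotient formula at κ + tT is used on this piece
    -- only.
    filter_upwards [eventually_isUnit_entire_add_smul (expBounded_denCoeff n) (hκ n)
      (adPiece 𝒜 T n)] with t ht
    rw [← adPiece_smul, ← adPiece_add] at ht ⊢
    have h1 := gradedOp_apply
      (fun n => holCalc (if n = 0 then coeff else coefF) (adPiece 𝒜 (κ + t • T) n)) x
    rw [holCalc_adPiece ht] at h1
    exact congrArg φ h1
  | add a b ha hb =>
    simp only [map_add]
    exact ha.fun_add hb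

theorem nabla_rMatrix {κ : 𝒜 0} (hκ : IsRegular κ) (T : 𝒜 0) :
    nabla (rMatrix 𝒜) κ T = rDeriv hκ T := by
  have h : ∃ D, HasDirDeriv (rMatrix 𝒜) κ T D := ⟨_, hasDirDeriv_rMatrix hκ T⟩
  rw [nabla, dif_pos h]
  exact h.choose_spec.unique (hasDirDeriv_rMatrix hκ T)

/-- ad [T, κ] is the commutator of ad κ with −ad T, so the divided difference collapses to a
commutator with R(κ). -/
theorem rDeriv_bracket {κ : 𝒜 0} (hκ : IsRegular κ) (T : 𝒜 0) :
    rDeriv hκ (adPiece 𝒜 T 0 κ) = ⁅LieAlgebra.ad ℂ A (T : A), rMatrix 𝒜 κ⁆ := by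
  refine linearMap_ext_homogeneous (𝒜 := 𝒜) fun n x => ?_
  rw [rDeriv_apply, dividedDiff_apply_of_intertwine (expBounded_numCoeff n) (expBounded_denCoeff n)
    (hκ n) (hκ n) (L := -adPiece 𝒜 T n) (fun y => by ext; simp [lie_lie, -lie_skew]; abel), LieRing.of_associative_ring_bracket,
    LinearMap.sub_apply, Module.End.mul_apply, Module.End.mul_apply, rMatrix_apply hκ,
    LieAlgebra.ad_apply, LieAlgebra.ad_apply, ← coe_adPiece, ← coe_adPiece, rMatrix_apply hκ,
    shiftedR, zero_smul, add_zero]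
  simp
  abel

/-! ### Antisymmetry -/

theorem neg_one_pow_mul_coshCoeff (k : ℕ) : (-1) ^ k * coshCoeff k = 1 * coshCoeff k := by
  have h : (-1 / 2 : ℂ) ^ k = (-1) ^ k * (1 / 2) ^ k := by rw [← mul_pow]; norm_num
  have h' : ((-1 : ℂ) ^ k) ^ 2 = 1 := by rw [← pow_mul, mul_comm, pow_mul]; norm_num
  rw [coshCoeff, h]
  linear_combination (1 / 4 * (1 / 2) ^ k * (k.factorial : ℂ)⁻¹) * h'

theorem neg_one_pow_mul_sinhCoeff (k : ℕ) : (-1) ^ k * sinhCoeff k = -1 * sinhCoeff k := by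
  have h : (-1 / 2 : ℂ) ^ k = (-1) ^ k * (1 / 2) ^ k := by rw [← mul_pow]; norm_num
  have h' : ((-1 : ℂ) ^ k) ^ 2 = 1 := by rw [← pow_mul, mul_comm, pow_mul]; norm_num
  rw [sinhCoeff, h]
  linear_combination (-1 / 2 * (1 / 2) ^ k * (k.factorial : ℂ)⁻¹) * h'

theorem neg_one_pow_mul_sinhDivCoeff (k : ℕ) :
    (-1) ^ k * sinhDivCoeff k = 1 * sinhDivCoeff k := by
  have h := neg_one_pow_mul_sinhCoeff (k + 1)
  rw [pow_succ] at h
  rw [sinhDivCoeff]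
  linear_combination -h

theorem neg_one_pow_mul_coshSubCoeff (k : ℕ) :
    (-1) ^ k * coshSubCoeff k = -1 * coshSubCoeff k := by
  have h := neg_one_pow_mul_coshCoeff (k + 1)
  have h' := neg_one_pow_mul_sinhDivCoeff (k + 1)
  rw [pow_succ] at h h'
  rw [coshSubCoeff]
  linear_combination h' - h

theorem quot_neg_coeff (n : Z) {V : Type*} [AddCommGroup V] [Module ℂ V] [FiniteDimensional ℂ V]
    {M : Module.End ℂ V} (hM : IsUnit (entire (denCoeff n) M)) :
    IsUnit (entire (denCoeff n) (-M)) ∧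
      quot (numCoeff n) (denCoeff n) (-M) = -quot (numCoeff n) (denCoeff n) M := by
  by_cases hn : n = 0
  · simp only [numCoeff, denCoeff, hn, if_true] at hM ⊢
    exact ⟨isUnit_entire_neg_of_parity neg_one_pow_mul_sinhDivCoeff one_ne_zero hM,
      quot_neg_of_parity one_ne_zero neg_one_pow_mul_coshSubCoeff neg_one_pow_mul_sinhDivCoeff hM⟩
  · simp only [numCoeff, denCoeff, hn, if_false] at hM ⊢
    exact ⟨isUnit_entire_neg_of_parity neg_one_pow_mul_sinhCoeff (by simp) hM,
      quot_neg_of_parity (s := -1) (by simp) (by simpa using neg_one_pow_mul_coshCoeff)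
        neg_one_pow_mul_sinhCoeff hM⟩

/-- By invariance the adjoint of ad κ + z is −(ad κ − z), and f, F are odd; hence the shift changes
sign. -/
theorem shiftedR_antisymm {B : LinearMap.BilinForm ℂ A} (hinv : B.lieInvariant A) {κ : 𝒜 0}
    {m n : Z} (hmn : m + n = 0) {z : ℂ}
    (hm : IsUnit (entire (denCoeff m) (adPiece 𝒜 κ m + z • (1 : Module.End ℂ (𝒜 m)))))
    (hn : IsUnit (entire (denCoeff n) (adPiece 𝒜 κ n + (-z) • (1 : Module.End ℂ (𝒜 n)))))
    (x : 𝒜 m) (y : 𝒜 n) : B (shiftedR κ m z x) y = -B x (shiftedR κ n (-z) y) := by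
  have hiff : m = 0 ↔ n = 0 := by
    constructor <;> rintro rfl <;> simpa using hmn
  have hnum : numCoeff m = numCoeff n := by simp only [numCoeff, hiff]
  have hden : denCoeff m = denCoeff n := by simp only [denCoeff, hiff]
  rw [shiftedR, shiftedR]
  rw [hden] at hm
  rw [hnum, hden]
  obtain ⟨h1, h2⟩ := quot_neg_coeff n hn
  have h3 := quot_adjoint (expBounded_numCoeff n) (expBounded_denCoeff n)
    ((B.domRestrict (𝒜 m)).compl₂ (𝒜 n).subtype) hm h1 (fun v w => by
      have := hinv (κ : A) (v : A) (w : A)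
      simp [this, -lie_skew]
      ring) x y
  rw [h2] at h3
  simpa using h3

end Pieces

/-! ### The modified Yang–Baxter equation -/

section YangBaxter

variable {Z : Type*} [AddCommGroup Z] [DecidableEq Z]
variable {A : Type*} [LieRing A] [LieAlgebra ℂ A]
variable {𝒜 : Z → Submodule ℂ A} [GradedLieAlgebra 𝒜]
theorem decompose_zero_of_ne {n : Z} (hn : n ≠ 0) (x : 𝒜 n) :
    DirectSum.decompose 𝒜 (x : A) 0 = 0 :=
  Subtype.ext (DirectSum.decompose_of_mem_ne 𝒜 x.2 hn)

theorem decompose_zero_self (x : 𝒜 0) : DirectSum.decompose 𝒜 (x : A) 0 = x :=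
  Subtype.ext (DirectSum.decompose_of_mem_same 𝒜 x.2)

theorem pieceBracket_swap {m n k : Z} (h : m + n = k) (h' : n + m = k) (x : 𝒜 m) (y : 𝒜 n) :
    pieceBracket h x y = -pieceBracket h' y x :=
  Subtype.ext (lie_skew (x : A) (y : A)).symm

/-! ### Shifting `ad κ` by a scalar -/

theorem shift_eq (κ : 𝒜 0) (n : Z) (t s : ℂ) : adPiece 𝒜 κ n + (t * s) • (1 : Module.End ℂ (𝒜 n)) =
    adPiece 𝒜 κ n + t • (s • (1 : Module.End ℂ (𝒜 n))) := by
  rw [smul_smul]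

/-- The inverse of `ad κ + z` on `A_0`, extended by zero. -/
noncomputable def shiftedInv (κ : 𝒜 0) (n : Z) (z : ℂ) : Module.End ℂ (𝒜 n) :=
  if n = 0 then Ring.inverse (adPiece 𝒜 κ n + z • (1 : Module.End ℂ (𝒜 n))) else 0

theorem shiftedInv_of_ne {n : Z} (hn : n ≠ 0) (κ : 𝒜 0) (z : ℂ) : shiftedInv κ n z = 0 :=
  if_neg hn

variable [∀ n, FiniteDimensional ℂ (𝒜 n)]

attribute [local instance] endNormedRing endNormedAlgebra

/-- The shift `z` avoids the poles on `A_n`. -/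
structure IsRegularShift (κ : 𝒜 0) (n : Z) (z : ℂ) : Prop where
  den : IsUnit (entire (denCoeff n) (adPiece 𝒜 κ n + z • (1 : Module.End ℂ (𝒜 n))))
  inv : IsUnit (adPiece 𝒜 κ n + z • (1 : Module.End ℂ (𝒜 n)))

theorem IsRegular.eventually_shift {κ : 𝒜 0} (hκ : IsRegular κ) (n : Z) {s : ℂ} (hs : s ≠ 0) :
    ∀ᶠ t in 𝓝[≠] (0 : ℂ), IsRegularShift κ n (t * s) := by
  have h1 := (eventually_isUnit_entire_add_smul (expBounded_denCoeff n) (hκ n)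
    (s • (1 : Module.End ℂ (𝒜 n)))).filter_mono (nhdsWithin_le_nhds (s := {0}ᶜ))
  have h2 : Tendsto (fun t : ℂ => -(t * s)) (𝓝[≠] 0) (𝓝[≠] 0) := by
    refine tendsto_nhdsWithin_iff.2 ⟨?_, ?_⟩
    · have : Continuous fun t : ℂ => -(t * s) := by fun_prop
      simpa using (this.tendsto 0).mono_left (nhdsWithin_le_nhds (s := {0}ᶜ))
    · filter_upwards [self_mem_nhdsWithin] with t ht
      have ht : t ≠ 0 := ht
      simp [ht, hs]
  filter_upwards [h1, h2.eventually (eventually_notMem_spectrum (adPiece 𝒜 κ n) 0)] with t h3 h4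
  refine ⟨by rwa [shift_eq], ?_⟩
  rw [spectrum.notMem_iff, Algebra.algebraMap_eq_smul_one] at h4
  convert! h4.neg using 1
  module

theorem IsRegularShift.isUnit_sinh {κ : 𝒜 0} {n : Z} {z : ℂ} (h : IsRegularShift κ n z) :
    IsUnit (entire sinhCoeff (adPiece 𝒜 κ n + z • (1 : Module.End ℂ (𝒜 n)))) := by
  have h1 := h.den
  by_cases hn : n = 0
  · rw [denCoeff, if_pos hn] at h1
    rw [entire_sinhCoeff_eq_mul]
    exact h.inv.mul h1
  · rwa [denCoeff, if_neg hn] at h1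

/-- On A_0 this is F = f + 1/z. Extending the inverse by zero gives the same formula on every piece.
-/
theorem IsRegularShift.quot_eq {κ : 𝒜 0} {n : Z} {z : ℂ} (h : IsRegularShift κ n z) :
    quot coshCoeff sinhCoeff (adPiece 𝒜 κ n + z • (1 : Module.End ℂ (𝒜 n))) =
      shiftedR κ n z + shiftedInv κ n z := by
  have h1 := h.den
  by_cases hn : n = 0
  · have hs := h.isUnit_sinh
    have hi := h.inv
    rw [shiftedR, shiftedInv, if_pos hn]
    rw [denCoeff, if_pos hn] at h1 ⊢
    rw [numCoeff, if_pos hn]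
    set M := adPiece 𝒜 κ n + z • (1 : Module.End ℂ (𝒜 n))
    ext v : 1
    obtain ⟨u, rfl⟩ := exists_entire_apply_eq hs v
    have hM : Ring.inverse M (M (entire sinhDivCoeff M u)) = entire sinhDivCoeff M u := by
      rw [← Module.End.mul_apply (Ring.inverse M), Ring.inverse_mul_cancel _ hi,
        Module.End.one_apply]
    rw [quot_apply_entire hs, entire_sinhCoeff_eq_mul, entire_coshCoeff_eq_add, LinearMap.add_apply,
      LinearMap.add_apply, Module.End.mul_apply, Module.End.mul_apply, hM,
      entire_intertwine expBounded_sinhDivCoeff (T := M) (fun _ => rfl), quot_apply_entire h1,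
      ← entire_intertwine expBounded_coshSubCoeff (T := M) (fun _ => rfl), add_comm]
  · rw [shiftedR, shiftedInv, if_neg hn, numCoeff, denCoeff, if_neg hn, if_neg hn, add_zero]

theorem IsRegularShift.shiftedInv_apply {κ : 𝒜 0} {z : ℂ} (h : IsRegularShift κ 0 z) (v : 𝒜 0) :
    shiftedInv κ 0 z ((adPiece 𝒜 κ 0 + z • (1 : Module.End ℂ (𝒜 0))) v) = v := by
  rw [shiftedInv, if_pos rfl, ← Module.End.mul_apply, Ring.inverse_mul_cancel _ h.inv,
    Module.End.one_apply]

theorem IsRegularShift.apply_shiftedInv {κ : 𝒜 0} {z : ℂ} (h : IsRegularShift κ 0 z) (v : 𝒜 0) :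
    (adPiece 𝒜 κ 0 + z • (1 : Module.End ℂ (𝒜 0))) (shiftedInv κ 0 z v) = v := by
  rw [shiftedInv, if_pos rfl, ← Module.End.mul_apply, Ring.mul_inverse_cancel _ h.inv,
    Module.End.one_apply]

/-- In degrees m = n = 0 this is the Leibniz rule applied to the two preimages. In all other cases
both sides vanish, because `shiftedInv` is zero off A_0. -/
theorem shiftedInv_bracket {κ : 𝒜 0} {m n k : Z} (h : m + n = k) {s t : ℂ}
    (hm : IsRegularShift κ m s) (hn : IsRegularShift κ n t) (hk : IsRegularShift κ k (s + t))
    (x : 𝒜 m) (y : 𝒜 n) :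
    pieceBracket h (shiftedInv κ m s x) (shiftedInv κ n t y) =
      shiftedInv κ k (s + t)
        (pieceBracket h x (shiftedInv κ n t y) + pieceBracket h (shiftedInv κ m s x) y) := by
  by_cases hm0 : m = 0
  · by_cases hn0 : n = 0
    · subst hm0 hn0
      obtain rfl : k = 0 := by rw [← h, add_zero]
      have h1 := pieceBracket_leibniz h κ s t (shiftedInv κ 0 s x) (shiftedInv κ 0 t y)
      rw [hm.apply_shiftedInv, hn.apply_shiftedInv] at h1
      rw [← h1, hk.shiftedInv_apply]
    · have hk0 : k ≠ 0 := by rwa [← h, hm0, zero_add]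
      simp [shiftedInv_of_ne hn0, shiftedInv_of_ne hk0]
  · by_cases hn0 : n = 0
    · have hk0 : k ≠ 0 := by rwa [← h, hn0, add_zero]
      simp [shiftedInv_of_ne hm0, shiftedInv_of_ne hk0]
    · simp [shiftedInv_of_ne hm0, shiftedInv_of_ne hn0]

/-- `coth_addition` with F = R + inverse. The terms with two inverses cancel by
`shiftedInv_bracket`; the grouping collects the others so that each group has a limit. -/
theorem shifted_yang_baxter {κ : 𝒜 0} {m n k : Z} (h : m + n = k) {s t : ℂ}
    (hm : IsRegularShift κ m s) (hn : IsRegularShift κ n t) (hk : IsRegularShift κ k (s + t))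
    (x : 𝒜 m) (y : 𝒜 n) :
    pieceBracket h (shiftedR κ m s x) (shiftedR κ n t y)
      - shiftedR κ k (s + t) (pieceBracket h x (shiftedR κ n t y)
          + pieceBracket h (shiftedR κ m s x) y)
      + (pieceBracket h (shiftedInv κ m s x) (shiftedR κ n t y)
          - shiftedR κ k (s + t) (pieceBracket h (shiftedInv κ m s x) y))
      + (pieceBracket h (shiftedR κ m s x) (shiftedInv κ n t y)
          - shiftedR κ k (s + t) (pieceBracket h x (shiftedInv κ n t y)))
      - shiftedInv κ k (s + t) (pieceBracket h x (shiftedR κ n t y)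
          + pieceBracket h (shiftedR κ m s x) y)
      = -(1 / 4 : ℂ) • pieceBracket h x y := by
  have h1 := coth_addition (pieceBracket h) (pieceBracket_leibniz h κ s t) hm.isUnit_sinh
    hn.isUnit_sinh hk.isUnit_sinh x y
  have h2 := shiftedInv_bracket h hm hn hk x y
  rw [hm.quot_eq, hn.quot_eq, hk.quot_eq] at h1
  rw [← h1]
  simp only [LinearMap.add_apply, map_add] at h2 ⊢
  rw [h2]
  abel

/-! ### Limits as the shift tends to zero -/

theorem tendsto_shiftedR {κ : 𝒜 0} (hκ : IsRegular κ) (n : Z) (s : ℂ) :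
    Tendsto (fun t : ℂ => shiftedR κ n (t * s)) (𝓝[≠] 0) (𝓝 (shiftedR κ n 0)) := by
  have h := (continuousAt_quot (expBounded_numCoeff n) (expBounded_denCoeff n) (hκ n)).tendsto.comp
    (tendsto_add_smul (adPiece 𝒜 κ n) (s • (1 : Module.End ℂ (𝒜 n))))
  simp only [shiftedR, shift_eq, zero_smul, add_zero]
  exact h.mono_left nhdsWithin_le_nhds

theorem tendsto_bracket_shiftedR {κ : 𝒜 0} (hκ : IsRegular κ) {m n k : Z} (h : m + n = k)
    (x : 𝒜 m) (y : 𝒜 n) (φ : Module.Dual ℂ (𝒜 k)) :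
    Tendsto (fun t : ℂ => φ (pieceBracket h (shiftedR κ m (t * 1) x) (shiftedR κ n (t * 1) y)
      - shiftedR κ k (t * 2) (pieceBracket h x (shiftedR κ n (t * 1) y)
          + pieceBracket h (shiftedR κ m (t * 1) x) y))) (𝓝[≠] 0)
      (𝓝 (φ (pieceBracket h (shiftedR κ m 0 x) (shiftedR κ n 0 y)
      - shiftedR κ k 0 (pieceBracket h x (shiftedR κ n 0 y)
          + pieceBracket h (shiftedR κ m 0 x) y)))) := by
  have hm := tendsto_shiftedR hκ m 1
  have hn := tendsto_shiftedR hκ n 1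
  have hk := tendsto_shiftedR hκ k 2
  let ev : Module.End ℂ (𝒜 k) →ₗ[ℂ] 𝒜 k →ₗ[ℂ] ℂ := LinearMap.compRight ℂ φ
  let c1 : Module.End ℂ (𝒜 m) →ₗ[ℂ] Module.End ℂ (𝒜 n) →ₗ[ℂ] ℂ :=
    ((pieceBracket h).compr₂ φ).compl₁₂ (LinearMap.applyₗ x) (LinearMap.applyₗ y)
  let c2 : Module.End ℂ (𝒜 k) →ₗ[ℂ] Module.End ℂ (𝒜 n) →ₗ[ℂ] ℂ :=
    ev.compl₂ (pieceBracket h x ∘ₗ LinearMap.applyₗ y)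
  let c3 : Module.End ℂ (𝒜 k) →ₗ[ℂ] Module.End ℂ (𝒜 m) →ₗ[ℂ] ℂ :=
    ev.compl₂ ((pieceBracket h).flip y ∘ₗ LinearMap.applyₗ x)
  have b1 := continuous_bilin (E := Module.End ℂ (𝒜 m)) (F := Module.End ℂ (𝒜 n)) c1
  have b2 := continuous_bilin (E := Module.End ℂ (𝒜 k)) (F := Module.End ℂ (𝒜 n)) c2
  have b3 := continuous_bilin (E := Module.End ℂ (𝒜 k)) (F := Module.End ℂ (𝒜 m)) c3
  have l1 := (b1.tendsto _).comp (hm.prodMk_nhds hn)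
  have l2 := (b2.tendsto _).comp (hk.prodMk_nhds hn)
  have l3 := (b3.tendsto _).comp (hk.prodMk_nhds hm)
  simpa [ev, c1, c2, c3, Function.comp_def] using l1.sub (l2.add l3)

/-- T' = (ad κ + εr)⁻¹T may blow up. Since r = s − t, however, ad T = (ad κ + εs) ad T' − ad T' (ad
κ + εt), so the expression is a divided difference applied to the fixed operator ad T. -/
theorem tendsto_rDeriv {κ : 𝒜 0} (hκ : IsRegular κ) (T : 𝒜 0) {n : Z} (y : 𝒜 n) {r s t : ℂ}
    (hr : r ≠ 0) (hs : s ≠ 0) (ht : t ≠ 0) (hrst : s - t = r) (φ : Module.Dual ℂ A) :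
    Tendsto (fun ε : ℂ => φ (shiftedR κ n (ε * s) (adPiece 𝒜 (shiftedInv κ 0 (ε * r) T) n y)
      - adPiece 𝒜 (shiftedInv κ 0 (ε * r) T) n (shiftedR κ n (ε * t) y) : 𝒜 n)) (𝓝[≠] 0)
      (𝓝 (φ (rDeriv hκ T y))) := by
  have h := (tendsto_dividedDiff (expBounded_numCoeff n) (expBounded_denCoeff n)
    (P := s • (1 : Module.End ℂ (𝒜 n))) (Q := t • (1 : Module.End ℂ (𝒜 n))) (adPiece 𝒜 T n)
    (hκ n) (hκ n) (φ ∘ₗ (𝒜 n).subtype) y).mono_left (nhdsWithin_le_nhds (s := {0}ᶜ))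
  rw [rDeriv_apply]
  refine h.congr' ?_
  filter_upwards [hκ.eventually_shift 0 hr, hκ.eventually_shift n hs, hκ.eventually_shift n ht]
    with ε h1 h2 h3
  rw [← shift_eq, ← shift_eq, dividedDiff_apply_of_intertwine (expBounded_numCoeff n)
    (expBounded_denCoeff n) h2.den h3.den (L := adPiece 𝒜 (shiftedInv κ 0 (ε * r) T) n)]
  · rfl
  · intro w
    apply Subtype.ext
    conv_lhs => rw [← h1.apply_shiftedInv T]
    simp only [← hrst, LinearMap.add_apply, LinearMap.smul_apply, Module.End.one_apply, map_add,
      map_smul, Submodule.coe_add, Submodule.coe_smul, coe_adPiece, AddSubgroupClass.coe_sub,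
      add_lie, smul_lie, lie_lie (κ : A)]
    module

theorem tendsto_left_pole {κ : 𝒜 0} (hκ : IsRegular κ) {m n k : Z} (h : m + n = k) (x : 𝒜 m)
    (y : 𝒜 n) (φ : Module.Dual ℂ A) :
    Tendsto (fun t : ℂ => φ (pieceBracket h (shiftedInv κ m (t * 1) x) (shiftedR κ n (t * 1) y)
          - shiftedR κ k (t * 2) (pieceBracket h (shiftedInv κ m (t * 1) x) y) : 𝒜 k)) (𝓝[≠] 0)
      (𝓝 (φ (-rDeriv hκ (DirectSum.decompose 𝒜 (x : A) 0) y))) := by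
  by_cases hm : m = 0
  · subst hm
    obtain rfl : n = k := by rw [← h, zero_add]
    rw [decompose_zero_self]
    -- Both arguments are shifted by t and the bracket by 2t, hence (r, s, t) = (1, 2, 1).
    have h1 := (tendsto_rDeriv hκ x y one_ne_zero two_ne_zero one_ne_zero (by norm_num) φ).neg
    rw [map_neg]
    refine h1.congr fun t => ?_
    rw [← map_neg, ← Submodule.coe_neg, neg_sub]
    rfl
  · rw [decompose_zero_of_ne hm]
    simp [shiftedInv_of_ne hm]

theorem tendsto_right_pole {κ : 𝒜 0} (hκ : IsRegular κ) {m n k : Z} (h : m + n = k) (x : 𝒜 m)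
    (y : 𝒜 n) (φ : Module.Dual ℂ A) :
    Tendsto (fun t : ℂ => φ (pieceBracket h (shiftedR κ m (t * 1) x) (shiftedInv κ n (t * 1) y)
          - shiftedR κ k (t * 2) (pieceBracket h x (shiftedInv κ n (t * 1) y)) : 𝒜 k)) (𝓝[≠] 0)
      (𝓝 (φ (rDeriv hκ (DirectSum.decompose 𝒜 (y : A) 0) x))) := by
  have h' : n + m = k := by rw [add_comm, h]
  have h1 := (tendsto_left_pole hκ h' y x φ).neg
  rw [map_neg, neg_neg] at h1
  refine h1.congr fun t => ?_
  rw [← map_neg, ← Submodule.coe_neg]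
  congr 2
  rw [pieceBracket_swap h h', pieceBracket_swap h h', map_neg]
  abel

/-! ### The pairing term -/

theorem apply_nablaPairing {B : LinearMap.BilinForm ℂ A} (hsymm : B.IsSymm)
    (hB : (B.restrict (𝒜 0)).Nondegenerate) {ι : Type*} [Fintype ι] [DecidableEq ι]
    (b : Module.Basis ι ℂ (𝒜 0)) {κ : 𝒜 0} (hκ : IsRegular κ) (T : 𝒜 0) (X Y : A) :
    B (T : A) (nablaPairing B hB b (rMatrix 𝒜) κ X Y) = B X (rDeriv hκ T Y) := by
  have h : (B.flip (nablaPairing B hB b (rMatrix 𝒜) κ X Y)) ∘ₗ (𝒜 0).subtype =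
      (B X) ∘ₗ (LinearMap.applyₗ Y) ∘ₗ (rDeriv hκ) := by
    refine b.ext fun j => ?_
    have hd : ∀ i, B (b j : A) ((B.restrict (𝒜 0)).dualBasis hB b i : A) =
        if j = i then 1 else 0 := by
      intro i
      rw [hsymm.eq]
      exact LinearMap.BilinForm.apply_dualBasis_left hB b i j
    simp [nablaPairing, hd, nabla_rMatrix hκ]
  exact LinearMap.congr_fun h T

theorem nablaPairing_eq_zero {B : LinearMap.BilinForm ℂ A}
    (hgr : ∀ m n : Z, m + n ≠ 0 → ∀ x ∈ 𝒜 m, ∀ y ∈ 𝒜 n, B x y = 0)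
    (hB : (B.restrict (𝒜 0)).Nondegenerate) {ι : Type*} [Fintype ι] [DecidableEq ι]
    (b : Module.Basis ι ℂ (𝒜 0)) {κ : 𝒜 0} (hκ : IsRegular κ) {m n : Z} (hmn : m + n ≠ 0)
    (x : 𝒜 m) (y : 𝒜 n) : nablaPairing B hB b (rMatrix 𝒜) κ (x : A) (y : A) = 0 := by
  refine Finset.sum_eq_zero fun i _ => ?_
  rw [nabla_rMatrix hκ, rDeriv_apply, hgr m n hmn _ x.2 _ (Subtype.mem _), zero_smul]

theorem nablaPairing_mem {B : LinearMap.BilinForm ℂ A}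
    (hB : (B.restrict (𝒜 0)).Nondegenerate) {ι : Type*} [Fintype ι] [DecidableEq ι]
    (b : Module.Basis ι ℂ (𝒜 0)) (κ : 𝒜 0) (X Y : A) :
    nablaPairing B hB b (rMatrix 𝒜) κ X Y ∈ 𝒜 0 :=
  Submodule.sum_mem _ fun _ _ => Submodule.smul_mem _ _ (Subtype.mem _)

theorem tendsto_pairing {B : LinearMap.BilinForm ℂ A} (hsymm : B.IsSymm)
    (hinv : B.lieInvariant A)
    (hgr : ∀ m n : Z, m + n ≠ 0 → ∀ x ∈ 𝒜 m, ∀ y ∈ 𝒜 n, B x y = 0)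
    (hB : (B.restrict (𝒜 0)).Nondegenerate) {ι : Type*} [Fintype ι] [DecidableEq ι]
    (b : Module.Basis ι ℂ (𝒜 0)) {κ : 𝒜 0} (hκ : IsRegular κ) {m n k : Z} (h : m + n = k)
    (x : 𝒜 m) (y : 𝒜 n) (φ : Module.Dual ℂ A) :
    Tendsto (fun t : ℂ => φ (shiftedInv κ k (t * 2)
      (pieceBracket h x (shiftedR κ n (t * 1) y) + pieceBracket h (shiftedR κ m (t * 1) x) y) : 𝒜 k))
      (𝓝[≠] 0) (𝓝 (φ (-nablaPairing B hB b (rMatrix 𝒜) κ (x : A) (y : A)))) := by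
  by_cases hk : k = 0
  · subst hk
    obtain ⟨T, hT⟩ : ∃ T : 𝒜 0, ∀ u : 𝒜 0, φ u = B (T : A) (u : A) := by
      refine ⟨((B.restrict (𝒜 0)).toDual hB).symm (φ ∘ₗ (𝒜 0).subtype), fun u => ?_⟩
      have := LinearMap.congr_fun
        (((B.restrict (𝒜 0)).toDual hB).apply_symm_apply (φ ∘ₗ (𝒜 0).subtype)) u
      exact this.symm
    -- Moving an operator across the form reverses its shift: the inverse at 2t becomes minus the
    -- inverse at −2t acting on T, and R at t on x becomes −R at −t. Hence (r, s, t) = (−2, −1, 1).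
    have h1 := (tendsto_rDeriv hκ T y (r := -2) (s := -1) (t := 1) (by norm_num) (by norm_num)
      one_ne_zero (by norm_num) (B (x : A))).neg
    have h2 : φ (-nablaPairing B hB b (rMatrix 𝒜) κ (x : A) (y : A)) = -B x (rDeriv hκ T y) := by
      rw [map_neg, hT ⟨_, nablaPairing_mem hB b κ x y⟩, apply_nablaPairing hsymm hB b hκ]
    rw [h2]
    refine h1.congr' ?_
    filter_upwards [hκ.eventually_shift 0 (s := 2) two_ne_zero,
      hκ.eventually_shift 0 (s := -2) (by norm_num), hκ.eventually_shift m (s := 1) one_ne_zero,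
      hκ.eventually_shift n (s := -1) (by norm_num)] with t h3 h4 h5 h6
    set T' := shiftedInv κ 0 (t * -2) T with hT'
    have hadj : ∀ u : 𝒜 0, B (T : A) (shiftedInv κ 0 (t * 2) u : 𝒜 0) = -B (T' : A) (u : A) := by
      intro u
      have e1 := h4.apply_shiftedInv T
      have e2 := h3.apply_shiftedInv u
      rw [← hT'] at e1
      set v := shiftedInv κ 0 (t * 2) u
      rw [← e1, ← e2]
      have := hinv (κ : A) (T' : A) (v : A)
      simp [this, -lie_skew]
      ring
    have hinv' : ∀ X Y : A, B (T' : A) ⁅X, Y⁆ = -B X ⁅(T' : A), Y⁆ := by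
      intro X Y
      have h8 := hinv X (T' : A) Y
      rw [← lie_skew, map_neg, LinearMap.neg_apply, neg_inj] at h8
      rw [← h8]
      exact hinv (T' : A) X Y
    have h7 : t * -1 = -(t * 1) := by ring
    rw [h7] at h6 ⊢
    have has := shiftedR_antisymm hinv h h5.den h6.den x (adPiece 𝒜 T' n y)
    rw [hT, hadj]
    simp only [Submodule.coe_add, coe_pieceBracket, map_add, hinv', AddSubgroupClass.coe_sub,
      map_sub] at has ⊢
    rw [coe_adPiece] at has
    rw [has, coe_adPiece T' n (shiftedR κ n (t * 1) y)]
    ring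
  · have hmn : m + n ≠ 0 := by rwa [h]
    simp [shiftedInv_of_ne hk, nablaPairing_eq_zero hgr hB b hκ hmn]

/-! ### Passage to the limit and assembly -/

theorem yang_baxter_homogeneous {B : LinearMap.BilinForm ℂ A} (hsymm : B.IsSymm)
    (hinv : B.lieInvariant A)
    (hgr : ∀ m n : Z, m + n ≠ 0 → ∀ x ∈ 𝒜 m, ∀ y ∈ 𝒜 n, B x y = 0)
    (hB : (B.restrict (𝒜 0)).Nondegenerate) {ι : Type*} [Fintype ι] [DecidableEq ι]
    (b : Module.Basis ι ℂ (𝒜 0)) {κ : 𝒜 0} (hκ : IsRegular κ) {m n : Z} (x : 𝒜 m) (y : 𝒜 n) :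
    ⁅rMatrix 𝒜 κ x, rMatrix 𝒜 κ y⁆
        - rMatrix 𝒜 κ (⁅(x : A), rMatrix 𝒜 κ y⁆ + ⁅rMatrix 𝒜 κ x, (y : A)⁆)
        + nablaPairing B hB b (rMatrix 𝒜) κ x y
        + rDeriv hκ (DirectSum.decompose 𝒜 (y : A) 0) x
        - rDeriv hκ (DirectSum.decompose 𝒜 (x : A) 0) y
      = -(1 / 4 : ℂ) • ⁅(x : A), (y : A)⁆ := by
  rw [← sub_eq_zero, ← Module.forall_dual_apply_eq_zero_iff ℂ]
  intro φ
  rw [map_sub, sub_eq_zero]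
  have l1 := tendsto_bracket_shiftedR hκ (rfl : m + n = m + n) x y (φ ∘ₗ (𝒜 (m + n)).subtype)
  have l2 := tendsto_left_pole hκ (rfl : m + n = m + n) x y φ
  have l3 := tendsto_right_pole hκ (rfl : m + n = m + n) x y φ
  have l4 := tendsto_pairing hsymm hinv hgr hB b hκ (rfl : m + n = m + n) x y φ
  have l := ((l1.add l2).add l3).sub l4
  have hconst : Tendsto (fun _ : ℂ => φ (-(1 / 4 : ℂ) • ⁅(x : A), (y : A)⁆)) (𝓝[≠] 0)
      (𝓝 (φ (-(1 / 4 : ℂ) • ⁅(x : A), (y : A)⁆))) := tendsto_const_nhds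
  -- For all small t ≠ 0 the shifted left side equals the same constant, so its limit does too.
  have hlim := tendsto_nhds_unique_of_eventuallyEq l hconst (by
    filter_upwards [hκ.eventually_shift m (s := 1) one_ne_zero,
      hκ.eventually_shift n (s := 1) one_ne_zero,
      hκ.eventually_shift (m + n) (s := 2) two_ne_zero] with t h1 h2 h3
    have h4 : t * 2 = t * 1 + t * 1 := by ring
    rw [h4] at h3 ⊢
    have h5 := congrArg (φ ∘ₗ (𝒜 (m + n)).subtype) (shifted_yang_baxter rfl h1 h2 h3 x y)
    rw [map_sub, map_add, map_add] at h5
    exact h5)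
  rw [← hlim, rMatrix_apply hκ, rMatrix_apply hκ, ← coe_pieceBracket (rfl : m + n = m + n),
    ← coe_pieceBracket (rfl : m + n = m + n), ← coe_pieceBracket (rfl : m + n = m + n),
    ← Submodule.coe_add, rMatrix_apply hκ]
  simp only [LinearMap.comp_apply, Submodule.coe_subtype, AddSubgroupClass.coe_sub, map_sub φ,
    map_add φ, map_neg φ]
  ring

theorem yang_baxter {B : LinearMap.BilinForm ℂ A} (hsymm : B.IsSymm)
    (hinv : B.lieInvariant A)
    (hgr : ∀ m n : Z, m + n ≠ 0 → ∀ x ∈ 𝒜 m, ∀ y ∈ 𝒜 n, B x y = 0)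
    (hB : (B.restrict (𝒜 0)).Nondegenerate) {ι : Type*} [Fintype ι] [DecidableEq ι]
    (b : Module.Basis ι ℂ (𝒜 0)) {κ : 𝒜 0} (hκ : IsRegular κ) (X Y : A) :
    ⁅rMatrix 𝒜 κ X, rMatrix 𝒜 κ Y⁆
        - rMatrix 𝒜 κ (⁅X, rMatrix 𝒜 κ Y⁆ + ⁅rMatrix 𝒜 κ X, Y⁆)
        + nablaPairing B hB b (rMatrix 𝒜) κ X Y
        + rDeriv hκ (DirectSum.decompose 𝒜 Y 0) X
        - rDeriv hκ (DirectSum.decompose 𝒜 X 0) Y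
      = -(1 / 4 : ℂ) • ⁅X, Y⁆ := by
  have hadd1 : ∀ X X' Y, nablaPairing B hB b (rMatrix 𝒜) κ (X + X') Y =
      nablaPairing B hB b (rMatrix 𝒜) κ X Y + nablaPairing B hB b (rMatrix 𝒜) κ X' Y := by
    intro X X' Y
    simp [nablaPairing, add_smul, Finset.sum_add_distrib]
  have hadd2 : ∀ X Y Y', nablaPairing B hB b (rMatrix 𝒜) κ X (Y + Y') =
      nablaPairing B hB b (rMatrix 𝒜) κ X Y + nablaPairing B hB b (rMatrix 𝒜) κ X Y' := by
    intro X Y Y'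
    simp [nablaPairing, add_smul, Finset.sum_add_distrib]
  induction X using DirectSum.Decomposition.inductionOn 𝒜 with
  | zero => simp [nablaPairing]
  | @homogeneous m x =>
    induction Y using DirectSum.Decomposition.inductionOn 𝒜 with
    | zero => simp [nablaPairing]
    | @homogeneous n y => exact yang_baxter_homogeneous hsymm hinv hgr hB b hκ x y
    | add Y Y' hY hY' =>
      simp only [map_add, lie_add, hadd2, DirectSum.decompose_add, DirectSum.add_apply,
        LinearMap.add_apply, smul_add] at hY hY' ⊢
      rw [← hY, ← hY']
      abel
  | add X X' hX hX' =>
    simp only [map_add, add_lie, hadd1, DirectSum.decompose_add, DirectSum.add_apply,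
      LinearMap.add_apply, smul_add] at hX hX' ⊢
    rw [← hX, ← hX']
    abel

theorem rMatrix_antisymm {B : LinearMap.BilinForm ℂ A} (hinv : B.lieInvariant A)
    (hgr : ∀ m n : Z, m + n ≠ 0 → ∀ x ∈ 𝒜 m, ∀ y ∈ 𝒜 n, B x y = 0) {κ : 𝒜 0} (hκ : IsRegular κ)
    (X Y : A) : B (rMatrix 𝒜 κ X) Y = -B X (rMatrix 𝒜 κ Y) := by
  have h : B ∘ₗ rMatrix 𝒜 κ = -(B.compl₂ (rMatrix 𝒜 κ)) := by
    refine linearMap_ext_homogeneous (𝒜 := 𝒜) fun m x => ?_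
    refine linearMap_ext_homogeneous (𝒜 := 𝒜) fun n y => ?_
    simp only [LinearMap.comp_apply, LinearMap.neg_apply, LinearMap.compl₂_apply, rMatrix_apply hκ]
    by_cases hmn : m + n = 0
    · have := shiftedR_antisymm hinv hmn (κ := κ) (z := 0) (by simpa using hκ m)
        (by simpa using hκ n) x y
      simpa using this
    · rw [hgr m n hmn _ (Subtype.mem _) _ y.2, hgr m n hmn _ x.2 _ (Subtype.mem _), neg_zero]
  have := LinearMap.congr_fun (LinearMap.congr_fun h X) Y
  simpa using this

end YangBaxter

end GradedRMatrix

theorem theorem1 {Z : Type*} [AddCommGroup Z] [DecidableEq Z]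
    {A : Type*} [LieRing A] [LieAlgebra ℂ A]
    (𝒜 : Z → Submodule ℂ A) [GradedLieAlgebra 𝒜]
    [∀ n, FiniteDimensional ℂ (𝒜 n)] [Nontrivial (𝒜 0)]
    (B : LinearMap.BilinForm ℂ A) (hnd : B.Nondegenerate) (hsymm : B.IsSymm)
    (hinv : B.lieInvariant A)
    (hgr : ∀ m n : Z, m + n ≠ 0 → ∀ x ∈ 𝒜 m, ∀ y ∈ 𝒜 n, B x y = 0)
    (Kc : Set (𝒜 0)) (hne : Kc.Nonempty) (hopen : IsOpen[moduleTopology ℂ (𝒜 0)] Kc)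
    (hspec : ∀ κ ∈ Kc, SpectralCondition 𝒜 κ) :
    ∀ κ ∈ Kc,
      -- `R` is differentiable at `κ` in all directions
      (∀ T : 𝒜 0, HasDirDeriv (rMatrix 𝒜) κ T (nabla (rMatrix 𝒜) κ T)) ∧
      -- the modified classical dynamical Yang-Baxter equation
      (∀ (b : Module.Basis (Fin (Module.finrank ℂ (𝒜 0))) ℂ (𝒜 0)) (X Y : A),
        ⁅rMatrix 𝒜 κ X, rMatrix 𝒜 κ Y⁆
          - rMatrix 𝒜 κ (⁅X, rMatrix 𝒜 κ Y⁆ + ⁅rMatrix 𝒜 κ X, Y⁆)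
          + nablaPairing B (restrict_nondegenerate hnd hgr) b (rMatrix 𝒜) κ X Y
          + nabla (rMatrix 𝒜) κ (DirectSum.decompose 𝒜 Y 0) X
          - nabla (rMatrix 𝒜) κ (DirectSum.decompose 𝒜 X 0) Y
        = -(1 / 4 : ℂ) • ⁅X, Y⁆) ∧
      -- antisymmetry
      (∀ X Y : A, B (rMatrix 𝒜 κ X) Y = -B X (rMatrix 𝒜 κ Y)) ∧
      -- equivariance: `(∇_{[T, κ]} R)(κ) = [ad T, R(κ)]`, where `adPiece 𝒜 T 0 κ` is `[T, κ]`
      (∀ T : 𝒜 0, nabla (rMatrix 𝒜) κ (adPiece 𝒜 T 0 κ) =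
        ⁅LieAlgebra.ad ℂ A (T : A), rMatrix 𝒜 κ⁆) := by
  intro κ hκ
  have hreg := (hspec κ hκ).isRegular
  refine ⟨fun T => ?_, fun b X Y => ?_, rMatrix_antisymm hinv hgr hreg, fun T => ?_⟩
  · rw [nabla_rMatrix hreg]
    exact hasDirDeriv_rMatrix hreg T
  · rw [nabla_rMatrix hreg, nabla_rMatrix hreg]
    exact yang_baxter hsymm hinv hgr _ b hreg X Y
  · rw [nabla_rMatrix hreg]
    exact rDeriv_bracket hreg T
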